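/- Let $\Sigma$ be a finite alphabet with distinct symbols $0,1\in\Sigma$; $\Sigma^*$ (finite words) carries the discrete topology, $\Sigma^\omega$ (infinite sequences) the Cantor topology, products the product topology. A multi-function $f:A\rightrightarrows B$ is given by a subset of $A\times B$; $f(a)$ is the set of all $b$ related to $a$, and $\mathrm{dom}(f)=\{a: f(a)\neq\emptyset\}$; partial functions are the multi-functions with at most one value at each argument. For $Y_0,\dots,Y_n\in\{\Sigma^*,\Sigma^\omega\}$, a Type-2 machine of type $(Y_1,\dots,Y_n\to Y_0)$ is a Turing machine with $n$ read-only input tapes, finitely many work tapes and a one-way output tape. If $Y_0=\Sigma^*$ its result is the word on the output tape when it halts; if $Y_0=\Sigma^\omega$ its result is $p$ if it computes forever and writes $p$ on the output tape. A partial function from $Y_1\times\dots\times Y_n$ to $Y_0$ is called computable if some extension of it is the function computed by a Type-2 machine, and continuous if it is continuous on its domain. A surjective (i.e. every $z\in Z$ lies in some $\delta(p)$) multi-function $\delta:Y\rightrightarrows Z$ is called a multi-representation if $Y=\Sigma^\omega$ and a multi-notation if $Y=\Sigma^*$. Given such $\delta_j:Y_j\rightrightarrows Z_j$, a partial function $f$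 from $Y_1\times\dots\times Y_n$ to $Y_0$ realizes $g:Z_1\times\dots\times Z_n\rightrightarrows Z_0$ if, whenever $z_j\in\delta_j(y_j)$ for $1\le j\le n$ and $g(z_1,\dots,z_n)\neq\emptyset$, the value $f(y_1,\dots,y_n)$ exists and $g(z_1,\dots,z_n)\cap\delta_0(f(y_1,\dots,y_n))\neq\emptyset$. The multi-function $g$ is $(\delta_1,\dots,\delta_n,\delta_0)$-computable (-continuous) if it is realized by a computable (continuous) partial function. A generalized Turing machine $\mathbf P$ has tapes $0,\dots,L$ (tapes $1,\dots,k$, where $k\le L$, are the input tapes, tape $0$ is the output tape), a finite work alphabet $\Gamma$ with a blank, a set $Z_i$ disjoint from $\Gamma$ for each tape $i$, and a finite set of labels with an initial label $l_0$ and a final label $l_f$. The cells of tape $i$, indexed by $\mathbb Z$, hold elements of $Z_i\cup\Gamma$, and each tape has a head. Every label $l\ne l_f$ has one of the following statements: move the head on tape $i$ one cell to the right (left) and go to $l'$; write $a\in\Gamma$ on the scanned cell of tape $i$ and go to $l'$; go to $l'$ if $a\in\Gamma$ is scanned on tape $i$ and to $l''$ otherwise; "$i:=f(i_1,\dots,i_n)$,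 go to $l'$" for a multi-function $f:Z_{i_1}\times\dots\times Z_{i_n}\rightrightarrows Z_i$ (write some element of $f(x_{i_1},\dots,x_{i_n})$ on the scanned cell of tape $i$); "if $f(i_1,\dots,i_n)$ then $l'$ else $l''$" for a partial function $f$ from $Z_{i_1}\times\dots\times Z_{i_n}$ to $\{0,1\}\subseteq\Sigma^*$ (go to $l'$ if $f(x_{i_1},\dots,x_{i_n})=0$ and to $l''$ if it is $1$). Here $x_j$ is the content of the scanned cell of tape $j$; if a required value is not defined (in particular if some $x_{i_j}\notin Z_{i_j}$), the configuration has no successor. A configuration is accepting if its label is $l_f$ and cell $0$ of tape $0$ contains an element of $Z_0$. On input $(x_1,\dots,x_k)$ the machine starts with label $l_0$, all heads on cell $0$, $x_i$ in cell $0$ of tape $i$ for $1\le i\le k$, and blanks elsewhere. The multi-function $f_{\mathbf P}:Z_1\times\dots\times Z_k\rightrightarrows Z_0$ computed by $\mathbf P$ is defined by: $x_0\in f_{\mathbf P}(x_1,\dots,x_k)$ iff every maximal computation on this input is finite and ends in an accepting configuration, and some such computation ends with $x_0$ in cell $0$ of tape $0$. **Theorem.** Let $\mathbf P$ be a generalized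 Turing machine and for every tape $i$, $0\le i\le L$, let $\delta_i:Y_i\rightrightarrows Z_i$ be a multi-representation or a multi-notation, $Y_i\in\{\Sigma^*,\Sigma^\omega\}$ (the choice may differ from tape to tape). Suppose that every $f$ in an assignment "$i:=f(i_1,\dots,i_n)$" of $\mathbf P$ is $(\delta_{i_1},\dots,\delta_{i_n},\delta_i)$-computable and every $f$ in a branching "if $f(i_1,\dots,i_n)$ then … else …" of $\mathbf P$ is $(\delta_{i_1},\dots,\delta_{i_n},\mathrm{id}_{\Sigma^*})$-computable. Then $f_{\mathbf P}$ is $(\delta_1,\dots,\delta_k,\delta_0)$-computable. The same holds with "continuous" in place of "computable" throughout. -/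

import Mathlib

namespace TTE

/-! ## Multi-functions and realization

A multi-function `f : X ⇉ Y` is a map `f : X → Set Y`; its domain is the set of those `x` for which
`f x` is nonempty.  A partial function is a `PFun`. -/

/-- A partial function, viewed as a multi-function. -/
def toMulti {X Y : Type*} (f : X →. Y) : X → Set Y := fun x => {y | y ∈ f x}

/-- `δ : U ⇉ Z` is a (generalized) multi-representation of `Z`: its range is all of `Z`. -/
def IsMultiRep {U Z : Type*} (δ : U → Set Z) : Prop := ∀ z, ∃ u, z ∈ δ u

/-- `f : X₁ × ⋯ × Xₙ ⇉ X₀` realizes `g : Y₁ × ⋯ × Yₙ ⇉ Y₀` via `(γ₁, …, γₙ, γ₀)`. -/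
def Realizes {n : ℕ} {X Y : Fin n → Type*} {X₀ Y₀ : Type*}
    (γ : ∀ j, X j → Set (Y j)) (γ₀ : X₀ → Set Y₀)
    (f : (∀ j, X j) → Set X₀) (g : (∀ j, Y j) → Set Y₀) : Prop :=
  ∀ (x : ∀ j, X j) (y : ∀ j, Y j), (∀ j, y j ∈ γ j (x j)) → (g y).Nonempty →
    (f x).Nonempty ∧ ∀ x₀ ∈ f x, (g y ∩ γ₀ x₀).Nonempty

/-! ## Finite and infinite words as names -/

/-- The two possible kinds of names: finite words and infinite sequences. -/
inductive NameKind
  | word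
  | seq

/-- The set of names of a given kind over the alphabet `A`. -/
def Names (A : Type*) : NameKind → Type _
  | .word => List A
  | .seq => ℕ → A

/-- Discrete topology on finite words, Cantor topology (the product of the discrete topologies) on
infinite sequences. -/
instance Names.topologicalSpace (A : Type*) : (κ : NameKind) → TopologicalSpace (Names A κ)
  | .word => (⊥ : TopologicalSpace (List A))
  | .seq => @Pi.topologicalSpace ℕ (fun _ => A) (fun _ => ⊥)

/-- The content of cell `m` of an input tape on which a name is written; the cells to the right of
a finite word are blank (`none`). -/
def Names.cell {A : Type*} : {κ : NameKind} → Names A κ → ℕ → Option A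
  | .word, w, m => (show List A from w)[m]?
  | .seq, p, m => some (p m)

/-! ## Type-2 machines -/

/-- What a Type-2 machine with `k` input tapes and `w` work tapes does in one step. -/
structure Type2Action (A : Type*) (k w : ℕ) (Q S : Type*) where
  /-- the next state -/
  next : Q
  /-- movements of the heads on the read-only input tapes (`none`: no movement) -/
  inputMove : Fin k → Option Turing.Dir
  /-- symbols written on the scanned cells of the work tapes -/
  write : Fin w → S
  /-- movements of the heads on the work tapes, after writing -/
  workMove : Fin w → Option Turing.Dir
  /-- the symbol appended to the content of the one-way output tape, if any -/
  out : Option A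

/-- A Type-2 machine over the alphabet `A`: a Turing machine with `k` read-only input tapes,
finitely many work tapes and a one-way output tape. -/
structure Type2Machine (A : Type*) (k : ℕ) where
  /-- states -/
  Q : Type
  [finQ : Finite Q]
  /-- work alphabet, with `default` as blank symbol -/
  S : Type
  [finS : Finite S]
  [inhS : Inhabited S]
  /-- number of work tapes -/
  w : ℕ
  /-- initial state -/
  start : Q
  /-- The program. The next action depends on the state and the symbols scanned by the heads on the
  input tapes and the work tapes; `none` means that the machine halts. -/
  prog : Q → (Fin k → Option A) → (Fin w → S) → Option (Type2Action A k w Q S)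

namespace Type2Machine

attribute [instance] finQ finS inhS

variable {A : Type*} {k : ℕ}

/-- Configurations. The input tapes are one-sided infinite, with cells `0, 1, 2, …`. -/
structure Cfg (M : Type2Machine A k) where
  /-- state -/
  state : M.Q
  /-- head positions on the input tapes -/
  pos : Fin k → ℕ
  /-- the work tapes with their heads -/
  work : Fin M.w → Turing.Tape M.S
  /-- the word that has been written on the output tape -/
  output : List A

/-- Movement of a head on an input tape; at the left end a movement to the left has no effect. -/
def moveInput : Option Turing.Dir → ℕ → ℕ
  | none, m => m
  | some .left, m => m - 1
  | some .right, m => m + 1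

/-- Movement of a head on a work tape. -/
def moveWork {S : Type*} [Inhabited S] : Option Turing.Dir → Turing.Tape S → Turing.Tape S
  | none, T => T
  | some d, T => T.move d

/-- One step on an input `x`; the result is `none` if the machine halts. -/
def step (M : Type2Machine A k) {κ : Fin k → NameKind} (x : ∀ j, Names A (κ j)) (c : M.Cfg) :
    Option M.Cfg :=
  (M.prog c.state (fun j => (x j).cell (c.pos j)) (fun j => (c.work j).head)).map fun a =>
    { state := a.next
      pos := fun j => moveInput (a.inputMove j) (c.pos j)
      work := fun j => moveWork (a.workMove j) ((c.work j).write (a.write j))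
      output := c.output ++ a.out.toList }

/-- The initial configuration: heads on the first cells, work tapes blank, output tape empty. -/
def init (M : Type2Machine A k) : M.Cfg where
  state := M.start
  pos := fun _ => 0
  work := fun _ => default
  output := []

/-- The graph of the function `f_M : Y₁ × ⋯ × Y_k → Y₀` computed by `M` under the type
specification `(κ, κ₀)`: for words as results, `M` halts with the result on the output tape; for
sequences as results, `M` computes forever and writes the result on the output tape, that is, every
symbol of the result is written at some time. -/
def Computes (M : Type2Machine A k) {κ : Fin k → NameKind} (x : ∀ j, Names A (κ j)) :
    {κ₀ : NameKind} → Names A κ₀ → Prop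
  | .word, v => ∃ c, StateTransition.Reaches (M.step x) M.init c ∧ M.step x c = none ∧ c.output = v
  | .seq, p => ∀ m, ∃ c, StateTransition.Reaches (M.step x) M.init c ∧ c.output[m]? = some (p m)

end Type2Machine

section Computability

variable {A : Type*} {n : ℕ} {κ : Fin n → NameKind} {κ₀ : NameKind}

/-- `f = f_M` for some Type-2 machine `M`. -/
def TuringComputable (f : (∀ j, Names A (κ j)) →. Names A κ₀) : Prop :=
  ∃ M : Type2Machine A n, ∀ x y, y ∈ f x ↔ M.Computes x y

/-- `f` has a Turing computable extension. -/
def IsComputable (f : (∀ j, Names A (κ j)) →. Names A κ₀) : Prop :=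
  ∃ g : (∀ j, Names A (κ j)) →. Names A κ₀, TuringComputable g ∧ ∀ x, ∀ y ∈ f x, y ∈ g x

/-- `f` is continuous on its domain (with the subspace topology). -/
def IsContinuous (f : (∀ j, Names A (κ j)) →. Names A κ₀) : Prop :=
  Continuous f.asSubtype

variable {Z : Fin n → Type*} {Z₀ : Type*}

/-- The multi-function `g` is `(δ₁, …, δₙ, δ₀)`-computable: it has a computable realization. -/
def RelComputable (δ : ∀ j, Names A (κ j) → Set (Z j)) (δ₀ : Names A κ₀ → Set Z₀)
    (g : (∀ j, Z j) → Set Z₀) : Prop :=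
  ∃ f : (∀ j, Names A (κ j)) →. Names A κ₀, IsComputable f ∧ Realizes δ δ₀ (toMulti f) g

/-- The multi-function `g` is `(δ₁, …, δₙ, δ₀)`-continuous: it has a continuous realization. -/
def RelContinuous (δ : ∀ j, Names A (κ j) → Set (Z j)) (δ₀ : Names A κ₀ → Set Z₀)
    (g : (∀ j, Z j) → Set Z₀) : Prop :=
  ∃ f : (∀ j, Names A (κ j)) →. Names A κ₀, IsContinuous f ∧ Realizes δ δ₀ (toMulti f) g

end Computability

/-- The identity on finite words, as a multi-notation of the set of finite words. -/
def idWord (A : Type*) : Names A .word → Set (List A) := fun w => {v | v = w}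

/-! ## Generalized Turing machines -/

/-- Statements with labels in `Lab` and work alphabet `Γ`, for the tapes `0, …, L` with the sets
`X i`. In a branching, the word `0` means true and the word `1` means false. -/
inductive Stmt (A : Type*) [Zero A] [One A] (Lab Γ : Type) {L : ℕ} (X : Fin (L + 1) → Type*)
  /-- `(i, right, l')` -/
  | right (i : Fin (L + 1)) (l' : Lab)
  /-- `(i, left, l')` -/
  | left (i : Fin (L + 1)) (l' : Lab)
  /-- `(i := a, l')` -/
  | write (i : Fin (L + 1)) (a : Γ) (l' : Lab)
  /-- `(i, if a then l', else l'')` -/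
  | test (i : Fin (L + 1)) (a : Γ) (l' l'' : Lab)
  /-- `(i := f(i₁, …, iₙ), l')` with a multi-function `f` -/
  | assign (i : Fin (L + 1)) (n : ℕ) (idx : Fin n → Fin (L + 1))
      (f : (∀ j, X (idx j)) → Set (X i)) (l' : Lab)
  /-- `(if f(i₁, …, iₙ) then l', else l'')` with a partial function `f` into `{0, 1}` -/
  | branch (n : ℕ) (idx : Fin n → Fin (L + 1)) (f : (∀ j, X (idx j)) →. List A)
      (hf : ∀ x, ∀ v ∈ f x, v = [0] ∨ v = [1]) (l' l'' : Lab)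

/-- Generalized Turing machines over the alphabet `A`. -/
structure GTM (A : Type*) [Zero A] [One A] where
  /-- labels -/
  Lab : Type
  [finLab : Finite Lab]
  /-- initial label -/
  l₀ : Lab
  /-- final label -/
  lf : Lab
  /-- work alphabet -/
  Γ : Type
  [finΓ : Finite Γ]
  /-- blank symbol -/
  b : Γ
  /-- number of input tapes -/
  k : ℕ
  /-- the tapes are `0, …, L` -/
  L : ℕ
  hk : k ≤ L
  /-- The sets assigned to the tapes; the cells of tape `i` hold elements of the disjoint union
  `X i ⊕ Γ`. -/
  X : Fin (L + 1) → Type*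
  /-- the statement of each non-final label -/
  stm : {l : Lab // l ≠ lf} → Stmt A Lab Γ X

namespace GTM

variable {A : Type*} [Zero A] [One A]

/-- The number of the `j`-th input tape: the input tapes are `1, …, k`. -/
def inTape (P : GTM A) (j : Fin P.k) : Fin (P.L + 1) := (Fin.castLE P.hk j).succ

/-- Configurations. -/
structure Cfg (P : GTM A) where
  /-- current label -/
  label : P.Lab
  /-- tape inscriptions -/
  tape : ∀ i, ℤ → P.X i ⊕ P.Γ
  /-- head positions -/
  head : Fin (P.L + 1) → ℤ

variable {P : GTM A}

/-- The content of the cell scanned by the head on tape `i`. -/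
def Cfg.scanned (c : P.Cfg) (i : Fin (P.L + 1)) : P.X i ⊕ P.Γ := c.tape i (c.head i)

/-- Change the label. -/
def Cfg.setLabel (c : P.Cfg) (l : P.Lab) : P.Cfg := { c with label := l }

/-- Move the head on tape `i` to position `m`. -/
def Cfg.setHead (c : P.Cfg) (i : Fin (P.L + 1)) (m : ℤ) : P.Cfg :=
  { c with head := Function.update c.head i m }

/-- Write `x` under the head of tape `i`. -/
def Cfg.setCell (c : P.Cfg) (i : Fin (P.L + 1)) (x : P.X i ⊕ P.Γ) : P.Cfg :=
  { c with tape := Function.update c.tape i (Function.update (c.tape i) (c.head i) x) }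

/-- The effect of a statement: `c'` is a possible result of executing it in `c`. -/
def Exec : Stmt A P.Lab P.Γ P.X → P.Cfg → P.Cfg → Prop
  | .right i l', c, c' => c' = (c.setHead i (c.head i + 1)).setLabel l'
  | .left i l', c, c' => c' = (c.setHead i (c.head i - 1)).setLabel l'
  | .write i a l', c, c' => c' = (c.setCell i (.inr a)).setLabel l'
  | .test i a l' l'', c, c' =>
      (c.scanned i = .inr a ∧ c' = c.setLabel l') ∨ (c.scanned i ≠ .inr a ∧ c' = c.setLabel l'')
  | .assign i n idx f l', c, c' =>
      ∃ x : ∀ j : Fin n, P.X (idx j), (∀ j, c.scanned (idx j) = .inl (x j)) ∧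
        ∃ y ∈ f x, c' = (c.setCell i (.inl y)).setLabel l'
  | .branch n idx f _ l' l'', c, c' =>
      ∃ x : ∀ j : Fin n, P.X (idx j), (∀ j, c.scanned (idx j) = .inl (x j)) ∧
        (([0] ∈ f x ∧ c' = c.setLabel l') ∨ ([1] ∈ f x ∧ c' = c.setLabel l''))

/-- The successor relation `⊢` on configurations. -/
def Step (c c' : P.Cfg) : Prop := ∃ h : c.label ≠ P.lf, Exec (P.stm ⟨c.label, h⟩) c c'

/-- Accepting configurations. -/
def Cfg.Accepting (c : P.Cfg) : Prop := c.label = P.lf ∧ ∃ y, c.tape 0 0 = .inl y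

/-- The initial configuration: the input `x j` is in cell `0` of the `j`-th input tape, all other
cells are blank, all heads are on position `0`. -/
def init (x : ∀ j, P.X (P.inTape j)) : P.Cfg where
  label := P.l₀
  tape := fun i => Fin.cases (motive := fun i => ℤ → P.X i ⊕ P.Γ) (fun _ => .inr P.b)
    (fun i m => if h : i.val < P.k ∧ m = 0 then .inl (x ⟨i.val, h.1⟩) else .inr P.b) i
  head := fun _ => 0

/-- Every maximal computation with first configuration `c` is accepting: there is no infinite
computation from `c`, and every finite computation from `c` whose last configuration has no
successor ends with an accepting configuration. -/
def AllAccepting (c : P.Cfg) : Prop :=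
  (¬ ∃ s : ℕ → P.Cfg, s 0 = c ∧ ∀ m, Step (s m) (s (m + 1))) ∧
    ∀ d, Relation.ReflTransGen Step c d → (¬ ∃ d', Step d d') → d.Accepting

variable (P)

/-- The multi-function `f_P : X₁ × ⋯ × X_k ⇉ X₀` computed by the machine `P`. -/
def fn (x : ∀ j, P.X (P.inTape j)) : Set (P.X 0) :=
  {y | AllAccepting (init x) ∧
    ∃ d, Relation.ReflTransGen Step (init x) d ∧ d.Accepting ∧ d.tape 0 0 = .inl y}

/-- All functions in the statements of `P` are computable with respect to the `δ i`. -/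
def RelComputable {κ : Fin (P.L + 1) → NameKind} (δ : ∀ i, Names A (κ i) → Set (P.X i)) : Prop :=
  ∀ l, match P.stm l with
    | .assign i _ idx f _ => TTE.RelComputable (fun j => δ (idx j)) (δ i) f
    | .branch _ idx f _ _ _ => TTE.RelComputable (fun j => δ (idx j)) (idWord A) (toMulti f)
    | _ => True

/-- All functions in the statements of `P` are continuous with respect to the `δ i`. -/
def RelContinuous {κ : Fin (P.L + 1) → NameKind} (δ : ∀ i, Names A (κ i) → Set (P.X i)) : Prop :=
  ∀ l, match P.stm l with
    | .assign i _ idx f _ => TTE.RelContinuous (fun j => δ (idx j)) (δ i) f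
    | .branch _ idx f _ _ _ => TTE.RelContinuous (fun j => δ (idx j)) (idWord A) (toMulti f)
    | _ => True

end GTM

end TTE

/-! The argument is a simulation on finite information. A name, word or sequence, is treated as its
function from cells to `Option A`, with `none` for the blanks after a word, and is approximated by
finite lists of such cell contents. A sequence of approximations converges (`Conv`) if every list is
correct and each cell is eventually covered; the lists need not grow monotonically. Since blanks are
part of the approximations, words and sequences are handled alike: for a word, convergence includes
eventually knowing where it ends.

A map `h` from a stage number and approximations of the arguments to an approximation of the value
tracks `f` if it sends convergent approximations to convergent ones. Both notions of the theorem
reduce to this one. A partial function is continuous iff some `h` tracks it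
(`isContinuous_of_tracks`, `exists_tracks_of_isContinuous`), and it has a machine-computable
extension iff some primitive recursive `h` tracks it. In one direction (`tracks_approxOutput`) `h`
runs the machine for `t` steps on the known cells. In the other (`exists_type2Machine`) a machine
reads one more cell of each input at every stage, evaluates `h`, and writes the next symbol if `h`
already supplies it.

For the generalized machine, all functions are first replaced by realizing functions on names. Every
step of the resulting machine is matched by some step of the original one, so if all maximal
computations of the original are accepting, the new machine halts with a name of a possible result
(`realizes_results`). That machine is then run for `t` steps on approximations at each stage `t`,
the functions being replaced by their tracking maps. Assignments always yield some approximation; a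
branching whose truth value is still unknown freezes the run, which then gives the empty
approximation. A halting computation consists of finitely many steps, so at all late stages the run
follows it to the end, and at earlier stages it outputs nothing wrong (`tracks_approxResult`). This
run is a bounded iteration, hence primitive recursive when the tracking maps are
(`GTM.primrec_approxResult`). -/

namespace TTE

section

/-! ## Approximations of names -/

/-- A finite approximation of a name: the contents of finitely many of its first cells. -/
abbrev Approx (A : Type*) := List (Option A)

/-- The content of the first `t` cells of a name. -/
def Names.take {A : Type*} {κ : NameKind} (y : Names A κ) (t : ℕ) : Approx A :=
  (List.range t).map y.cell

/-- The approximations `a 0, a 1, …` are correct for `y` and eventually determine each cell. -/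
def Conv {A : Type*} {κ : NameKind} (a : ℕ → Approx A) (y : Names A κ) : Prop :=
  (∀ t m v, (a t)[m]? = some v → y.cell m = v) ∧ ∀ m, ∃ T, ∀ t ≥ T, m < (a t).length

/-- `h` computes approximations of the values of `f` from approximations of the arguments. -/
def Tracks {A : Type*} {n : ℕ} {κ : Fin n → NameKind} {κ₀ : NameKind}
    (h : ℕ → (Fin n → Approx A) → Approx A)
    (f : (∀ j, Names A (κ j)) → Set (Names A κ₀)) : Prop :=
  ∀ x, ∀ y ∈ f x, ∀ a : ℕ → Fin n → Approx A, (∀ j, Conv (fun t => a t j) (x j)) →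
    Conv (fun t => h t (a t)) y

variable {A : Type*} {n : ℕ} {κ : Fin n → NameKind} {κ₀ κ₁ : NameKind}

theorem Names.cell_injective : ∀ {κ : NameKind},
    Function.Injective (Names.cell : Names A κ → ℕ → Option A)
  | .word, _, _, h => List.ext_getElem? fun m => congrFun h m
  | .seq, _, _, h => funext fun m => Option.some_injective _ (congrFun h m)

theorem Names.getElem?_take (y : Names A κ₁) (t m : ℕ) :
    (y.take t)[m]? = if m < t then some (y.cell m) else none := by
  unfold Names.take
  split_ifs with h <;> simp [h]

theorem Names.length_take (y : Names A κ₁) (t : ℕ) : (y.take t).length = t := by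
  simp [Names.take]

theorem Names.take_succ (y : Names A κ₁) (t : ℕ) : y.take (t + 1) = y.take t ++ [y.cell t] := by
  simp [Names.take, List.range_succ]

theorem Names.conv_take (y : Names A κ₁) : Conv (fun t => y.take t) y := by
  refine ⟨fun t m v h => ?_, fun m => ⟨m + 1, fun t ht => ?_⟩⟩
  · simp only [Names.getElem?_take] at h
    split_ifs at h with hm
    exact Option.some_injective _ h
  · simp only [Names.length_take]; omega

theorem Conv.getElem? {a : ℕ → Approx A} {y : Names A κ₁} (h : Conv a y) (m : ℕ) :
    ∃ T : ℕ, ∀ t ≥ T, (a t)[m]? = some (y.cell m) := by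
  obtain ⟨T, hT⟩ := h.2 m
  refine ⟨T, fun t ht => ?_⟩
  have hm : (a t)[m]? = some ((a t)[m]'(hT t ht)) := List.getElem?_eq_getElem (hT t ht)
  rw [hm, h.1 t m _ hm]

theorem Conv.unique {a : ℕ → Approx A} {y y' : Names A κ₁} (h : Conv a y) (h' : Conv a y') :
    y = y' := by
  refine Names.cell_injective (funext fun m => ?_)
  obtain ⟨T, hT⟩ := h.getElem? m
  exact (h'.1 T m _ (hT T le_rfl)).symm

/-- Limits of approximations are unique. This makes the results of machines single-valued without a
separate determinism argument. -/
theorem Tracks.unique {h : ℕ → (Fin n → Approx A) → Approx A}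
    {f : (∀ j, Names A (κ j)) → Set (Names A κ₀)} (hf : Tracks h f) {x y y'} (hy : y ∈ f x)
    (hy' : y' ∈ f x) : y = y' :=
  (hf x y hy (fun t j => (x j).take t) fun j => (x j).conv_take).unique
    (hf x y' hy' _ fun j => (x j).conv_take)

/-! ## Continuity in terms of approximations -/

theorem Names.take_eq_take_iff {y y' : Names A κ₁} {t : ℕ} :
    y'.take t = y.take t ↔ ∀ m < t, y'.cell m = y.cell m := by
  simp [Names.take]

/-- The blank at position `w.length` shows that `v` is not longer than `w`; hence the bound
`w.length + 1`. This is why approximations by cells are compatible with the discrete topology on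
words. -/
theorem eq_of_getElem?_eq {v w : List A} (h : ∀ m < w.length + 1, v[m]? = w[m]?) : v = w := by
  refine List.ext_getElem? fun m => ?_
  rcases lt_or_ge m (w.length + 1) with hm | hm
  · exact h m hm
  · have hw := h _ (Nat.lt_succ_self _)
    rw [List.getElem?_eq_none le_rfl, List.getElem?_eq_none_iff] at hw
    rw [List.getElem?_eq_none (by omega), List.getElem?_eq_none (by omega)]

theorem mem_nhds_seq_iff [TopologicalSpace A] [DiscreteTopology A] {p : ℕ → A} {s : Set (ℕ → A)} :
    s ∈ nhds p ↔ ∃ t, {p' : ℕ → A | ∀ m < t, p' m = p m} ⊆ s := by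
  rw [nhds_pi, Filter.mem_pi]
  constructor
  · rintro ⟨I, hI, t, ht, hs⟩
    obtain ⟨N, hN⟩ := hI.bddAbove
    refine ⟨N + 1, fun p' hp' => hs fun m hm => ?_⟩
    have h1 : p' m = p m := hp' m (Nat.lt_succ_of_le (hN hm))
    rw [h1]
    exact mem_of_mem_nhds (ht m)
  · rintro ⟨N, hN⟩
    refine ⟨Set.Iio N, Set.finite_Iio N, fun m => {p m}, fun m => by simp, fun p' hp' => ?_⟩
    exact hN fun m hm => hp' m hm

/-- The names with the same first `t` cells form a neighbourhood basis. -/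
theorem Names.nhds_hasBasis : ∀ {κ₁ : NameKind} (y : Names A κ₁),
    (nhds y).HasBasis (fun _ : ℕ => True) fun t => {y' | y'.take t = y.take t}
  | .word, w => by
    have : DiscreteTopology (Names A .word) := ⟨rfl⟩
    refine ⟨fun s => ?_⟩
    rw [nhds_discrete, Filter.mem_pure]
    refine ⟨fun hs => ⟨List.length (α := A) w + 1, trivial, fun v hv => ?_⟩,
      fun ⟨t, _, ht⟩ => ht rfl⟩
    have hvw : v = w := eq_of_getElem?_eq (Names.take_eq_take_iff.1 hv)
    rwa [hvw]
  | .seq, p => by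
    let _ : TopologicalSpace A := ⊥
    have : DiscreteTopology A := ⟨rfl⟩
    refine ⟨fun s => (mem_nhds_seq_iff (A := A) (p := p) (s := s)).trans ?_⟩
    simp only [true_and]
    refine exists_congr fun t => forall_congr' fun p' => imp_congr ?_ Iff.rfl
    refine Iff.trans (b := ∀ m < t, (some (p' m) : Option A) = some (p m)) ?_
      (Names.take_eq_take_iff (y := p) (y' := p')).symm
    exact forall₂_congr fun m _ => Option.some_inj.symm

/-- As there are finitely many arguments, one prefix length, the supremum, serves for all of them.
-/
theorem Names.nhds_pi_hasBasis (x : ∀ j, Names A (κ j)) :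
    (nhds x).HasBasis (fun _ : ℕ => True) fun t => {x' | ∀ j, (x' j).take t = (x j).take t} := by
  refine ⟨fun s => ?_⟩
  rw [nhds_pi, (Filter.hasBasis_pi fun j => Names.nhds_hasBasis (x j)).mem_iff]
  constructor
  · rintro ⟨⟨I, N⟩, -, hs⟩
    refine ⟨Finset.univ.sup N, trivial, fun x' hx' => hs fun j _ => ?_⟩
    exact Names.take_eq_take_iff.2 fun m hm => Names.take_eq_take_iff.1 (hx' j) m
      (hm.trans_le (Finset.le_sup (Finset.mem_univ j)))
  · rintro ⟨N, -, hs⟩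
    exact ⟨⟨Set.univ, fun _ => N⟩, ⟨Set.finite_univ, fun _ _ => trivial⟩,
      fun x' hx' => hs fun j => hx' j trivial⟩

theorem isContinuous_iff {f : (∀ j, Names A (κ j)) →. Names A κ₀} :
    IsContinuous f ↔ ∀ x, ∀ y ∈ f x, ∀ M, ∃ N, ∀ x', ∀ y' ∈ f x',
      (∀ j, (x' j).take N = (x j).take N) → y'.take M = y.take M := by
  have key : ∀ s : f.Dom, ContinuousAt f.asSubtype s ↔ ∀ M, ∃ N, ∀ s' : f.Dom,
      (∀ j, (s'.1 j).take N = (s.1 j).take N) →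
        (f.asSubtype s').take M = (f.asSubtype s).take M := by
    intro s
    rw [ContinuousAt, nhds_subtype, ((Names.nhds_pi_hasBasis s.1).comap _).tendsto_iff
      (Names.nhds_hasBasis _)]
    simp
  rw [IsContinuous, continuous_iff_continuousAt]
  simp only [key]
  constructor
  · intro h x y hy M
    obtain ⟨N, hN⟩ := h ⟨x, Part.dom_iff_mem.2 ⟨y, hy⟩⟩ M
    refine ⟨N, fun x' y' hy' hx' => ?_⟩
    have h1 : f.asSubtype ⟨x', Part.dom_iff_mem.2 ⟨y', hy'⟩⟩ = y' :=
      Part.mem_unique (Part.get_mem _) hy'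
    have h2 : f.asSubtype ⟨x, Part.dom_iff_mem.2 ⟨y, hy⟩⟩ = y := Part.mem_unique (Part.get_mem _) hy
    rw [← h1, ← h2]
    exact hN ⟨x', Part.dom_iff_mem.2 ⟨y', hy'⟩⟩ hx'
  · intro h s M
    obtain ⟨N, hN⟩ := h s.1 (f.asSubtype s) (Part.get_mem _) M
    exact ⟨N, fun s' hs' => hN s'.1 _ (Part.get_mem _) hs'⟩

/-- At a fixed stage `T` the tracking map sees only the first `T` cells of the arguments, and equal
prefixes give the same approximation, correct for both values. So `T` is a modulus of continuity
once that approximation covers `M` cells. -/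
theorem isContinuous_of_tracks {h : ℕ → (Fin n → Approx A) → Approx A}
    {f : (∀ j, Names A (κ j)) →. Names A κ₀} (hf : Tracks h (toMulti f)) : IsContinuous f := by
  refine isContinuous_iff.2 fun x y hy M => ?_
  have hc := hf x y hy (fun t j => (x j).take t) fun j => (x j).conv_take
  obtain ⟨T, hT⟩ := hc.2 M
  refine ⟨T, fun x' y' hy' hx' => Names.take_eq_take_iff.2 fun m hm => ?_⟩
  have hc' := hf x' y' hy' (fun t j => (x' j).take t) fun j => (x' j).conv_take
  have hlt := hm.trans (hT T le_rfl)
  have e := List.getElem?_eq_getElem hlt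
  rw [hc.1 T m _ e]
  refine hc'.1 T m _ ?_
  simp only [hx', e]

/-- The values of `f` at the arguments with approximations `a`. -/
def compatibleValues (f : (∀ j, Names A (κ j)) →. Names A κ₀) (a : Fin n → Approx A) :
    Set (Names A κ₀) :=
  {y | ∃ x, y ∈ f x ∧ ∀ j m v, (a j)[m]? = some v → (x j).cell m = v}

-- The tracking map outputs, among the first `t` cells, the longest initial run on which all values
-- compatible with the given approximations agree. The true value is always compatible, so this is
-- correct; continuity makes each cell determined from some stage on.
open Classical in
theorem exists_tracks_of_isContinuous {f : (∀ j, Names A (κ j)) →. Names A κ₀}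
    (hf : IsContinuous f) : ∃ h, Tracks h (toMulti f) := by
  let det (a : Fin n → Approx A) (m : ℕ) : Prop :=
    ∃ v, ∀ y ∈ compatibleValues f a, y.cell m = v
  let val (a : Fin n → Approx A) (m : ℕ) : Option A :=
    Classical.epsilon fun v => ∀ y ∈ compatibleValues f a, y.cell m = v
  have hval : ∀ a m, det a m → ∀ y ∈ compatibleValues f a, y.cell m = val a m :=
    fun a m h => Classical.epsilon_spec h
  refine ⟨fun t a => ((List.range t).takeWhile fun m => decide (det a m)).map (val a),
    fun x y hy a ha => ?_⟩
  have hmem : ∀ t, y ∈ compatibleValues f (a t) := fun t => ⟨x, hy, fun j => (ha j).1 t⟩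
  have hpre : ∀ t k, k ≤ t → (∀ m < k, det (a t) m) →
      List.range k <+: (List.range t).takeWhile fun m => decide (det (a t) m) := by
    intro t k hk hd
    obtain ⟨r, hr⟩ : List.range k <+: List.range t := by
      obtain ⟨d, rfl⟩ := Nat.exists_eq_add_of_le hk
      rw [List.range_add]
      exact List.prefix_append _ _
    rw [← hr, List.takeWhile_append_of_pos (by simpa using hd)]
    exact List.prefix_append _ _
  constructor
  · intro t m v h
    rw [List.getElem?_map, Option.map_eq_some_iff] at h
    obtain ⟨m', hm', rfl⟩ := h
    -- `takeWhile` keeps an initial segment of `0, 1, …`, so its entry at position `m` is `m`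
    -- itself.
    have h1 : m' = m := by
      have h2 := List.prefix_iff_getElem?.1 (List.takeWhile_prefix _) m
        (List.getElem?_eq_some_iff.1 hm').1
      rw [List.getElem?_eq_some_iff] at hm' h2
      obtain ⟨_, h3⟩ := hm'
      obtain ⟨_, h4⟩ := h2
      rw [h3, List.getElem_range] at h4
      exact h4.symm
    subst h1
    refine hval _ _ ?_ y (hmem t)
    simpa using List.mem_takeWhile_imp (List.mem_of_getElem? hm')
  · intro m
    obtain ⟨N, hN⟩ := isContinuous_iff.1 hf x y hy (m + 1)
    have hT : ∀ j, ∃ T, ∀ t ≥ T, N < (a t j).length := fun j => (ha j).2 N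
    choose T hT using hT
    refine ⟨max (m + 1) (Finset.univ.sup T), fun t ht => ?_⟩
    have := (hpre t (m + 1) (le_of_max_le_left ht) fun m' hm' => ⟨y.cell m', ?_⟩).length_le
    · simpa using this
    · rintro y' ⟨x', hy', hx'⟩
      refine Names.take_eq_take_iff.1 (hN x' y' hy' fun j => ?_) m' hm'
      refine Names.take_eq_take_iff.2 fun i hi => ?_
      have hlt : i < (a t j).length := hi.trans
        (hT j t ((Finset.le_sup (Finset.mem_univ j)).trans (le_of_max_le_right ht)))
      rw [hx' j i _ (List.getElem?_eq_getElem hlt), (ha j).1 t i _ (List.getElem?_eq_getElem hlt)]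

end

section

/-! ## Replacing objects by names in a generalized Turing machine -/

section Realization

variable {A : Type*} [Zero A] [One A]

/-- The functions in the second statement realize those in the first one. -/
inductive StmtRealizes {Lab Γ : Type} {L : ℕ} {X : Fin (L + 1) → Type*}
    {κ : Fin (L + 1) → NameKind} (δ : ∀ i, Names A (κ i) → Set (X i)) :
    Stmt A Lab Γ X → Stmt A Lab Γ (fun i => Names A (κ i)) → Prop
  | right (i l') : StmtRealizes δ (.right i l') (.right i l')
  | left (i l') : StmtRealizes δ (.left i l') (.left i l')
  | write (i a l') : StmtRealizes δ (.write i a l') (.write i a l')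
  | test (i a l' l'') : StmtRealizes δ (.test i a l' l'') (.test i a l' l'')
  | assign (i n idx f g l') (h : Realizes (fun j => δ (idx j)) (δ i) g f) :
      StmtRealizes δ (.assign i n idx f l') (.assign i n idx g l')
  | branch (n idx f hf g hg l' l'')
      (h : Realizes (fun j => δ (idx j)) (idWord A) (toMulti g) (toMulti f)) :
      StmtRealizes δ (.branch n idx f hf l' l'') (.branch n idx g hg l' l'')

namespace GTM

/-- The machine `P` with other sets and statements. -/
abbrev withStatements (P : GTM A) (X' : Fin (P.L + 1) → Type*)
    (stm' : {l : P.Lab // l ≠ P.lf} → Stmt A P.Lab P.Γ X') : GTM A :=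
  { P with X := X', stm := stm' }

/-- The results of the computations of `P` that end in an accepting configuration. -/
def results (P : GTM A) (x : ∀ j, P.X (P.inTape j)) : Set (P.X 0) :=
  {y | ∃ d, Relation.ReflTransGen Step (init x) d ∧ d.label = P.lf ∧ d.tape 0 0 = .inl y}

theorem AllAccepting.step {P : GTM A} {c d : P.Cfg} (h : AllAccepting c) (hs : Step c d) :
    AllAccepting d := by
  refine ⟨fun ⟨s, h0, hstep⟩ => h.1 ⟨fun m => Nat.casesOn m c s, rfl, fun m => ?_⟩,
    fun e he => h.2 e (.head hs he)⟩
  cases m with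
  | zero => simpa [h0] using hs
  | succ m => exact hstep m

/-- A stuck computation would be maximal without being accepting. So no function is ever evaluated
outside its domain, which is exactly where realization gives no information. -/
theorem AllAccepting.exists_step {P : GTM A} {c : P.Cfg} (h : AllAccepting c)
    (hc : c.label ≠ P.lf) : ∃ d, Step c d :=
  by_contra fun hn => hc (h.2 c .refl hn).1

variable {P : GTM A} {κ : Fin (P.L + 1) → NameKind} {δ : ∀ i, Names A (κ i) → Set (P.X i)}
  {stm' : {l : P.Lab // l ≠ P.lf} → Stmt A P.Lab P.Γ fun i => Names A (κ i)}

/-- In the first configuration, each object of the second one is replaced by one of its names. -/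
structure IsNamed (δ : ∀ i, Names A (κ i) → Set (P.X i))
    (c' : (P.withStatements (fun i => Names A (κ i)) stm').Cfg) (c : P.Cfg) : Prop where
  label : c'.label = c.label
  head : c'.head = c.head
  tape : ∀ i m, Sum.LiftRel (fun u z => z ∈ δ i u) (· = ·) (c'.tape i m) (c.tape i m)

variable {c' d' : (P.withStatements (fun i => Names A (κ i)) stm').Cfg} {c d : P.Cfg}

theorem IsNamed.scanned (h : IsNamed δ c' c) (i : Fin (P.L + 1)) :
    Sum.LiftRel (fun u z => z ∈ δ i u) (· = ·) (c'.scanned i) (c.scanned i) := by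
  rw [Cfg.scanned, Cfg.scanned, ← h.head]
  exact h.tape i _

theorem IsNamed.setLabel (h : IsNamed δ c' c) (l : P.Lab) :
    IsNamed δ (c'.setLabel l) (c.setLabel l) :=
  ⟨rfl, h.head, h.tape⟩

theorem IsNamed.setHead (h : IsNamed δ c' c) (i : Fin (P.L + 1)) (m : ℤ) :
    IsNamed δ (c'.setHead i m) (c.setHead i m) :=
  ⟨h.label, by simp only [Cfg.setHead, h.head], h.tape⟩

theorem IsNamed.setCell (h : IsNamed δ c' c) {i : Fin (P.L + 1)} {x' x}
    (hx : Sum.LiftRel (fun u z => z ∈ δ i u) (· = ·) x' x) :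
    IsNamed δ (c'.setCell i x') (c.setCell i x) := by
  refine ⟨h.label, h.head, fun k m => ?_⟩
  simp only [Cfg.setCell, h.head]
  by_cases hk : k = i
  · subst hk
    simp only [Function.update_self]
    by_cases hm : m = c.head k
    · subst hm; simpa only [Function.update_self] using hx
    · simpa only [Function.update_of_ne hm] using h.tape k m
  · simpa only [Function.update_of_ne hk] using h.tape k m

theorem IsNamed.exists_inl (h : IsNamed δ c' c) {n : ℕ} {idx : Fin n → Fin (P.L + 1)}
    {x : ∀ j, P.X (idx j)} (hx : ∀ j, c.scanned (idx j) = .inl (x j)) :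
    ∃ x' : ∀ j, Names A (κ (idx j)), (∀ j, c'.scanned (idx j) = .inl (x' j)) ∧
      ∀ j, x j ∈ δ (idx j) (x' j) := by
  have : ∀ j, ∃ u : Names A (κ (idx j)), c'.scanned (idx j) = .inl u ∧ x j ∈ δ (idx j) u := by
    intro j
    have hj := h.scanned (idx j)
    rw [hx j] at hj
    generalize c'.scanned (idx j) = s at hj ⊢
    cases hj with
    | inl hu => exact ⟨_, rfl, hu⟩
  choose x' h1 h2 using this
  exact ⟨x', h1, h2⟩

/-- A step of the original machine witnesses that the function involved is defined, hence the
realizing function is defined on the names. -/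
theorem IsNamed.exists_exec (h : IsNamed δ c' c) {s s'} (hs : StmtRealizes δ s s')
    (hd : Exec s c d) :
    ∃ d' : (P.withStatements (fun i => Names A (κ i)) stm').Cfg, Exec s' c' d' := by
  cases hs with
  | right | left | write => exact ⟨_, rfl⟩
  | test i a l' l'' =>
    by_cases ha : c'.scanned i = .inr a
    · exact ⟨_, .inl ⟨ha, rfl⟩⟩
    · exact ⟨_, .inr ⟨ha, rfl⟩⟩
  | assign i n idx f g l' hr =>
    obtain ⟨x, hx, y, hy, -⟩ := hd
    obtain ⟨x', hx', hxx⟩ := h.exists_inl hx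
    obtain ⟨y', hy'⟩ := (hr x' x hxx ⟨y, hy⟩).1
    exact ⟨_, x', hx', y', hy', rfl⟩
  | branch n idx f hf g hg l' l'' hr =>
    obtain ⟨x, hx, hv⟩ := hd
    obtain ⟨x', hx', hxx⟩ := h.exists_inl hx
    obtain ⟨v', hv'⟩ := (hr x' x hxx (hv.elim (fun hv => ⟨_, hv.1⟩) fun hv => ⟨_, hv.1⟩)).1
    rcases hg x' v' hv' with rfl | rfl
    · exact ⟨_, x', hx', .inl ⟨hv', rfl⟩⟩
    · exact ⟨_, x', hx', .inr ⟨hv', rfl⟩⟩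

/-- The value computed on names is a name of some admissible value, and the original machine may
choose that one. Which choice is matched depends on the names, so the lifting goes from names to
objects and not conversely. -/
theorem IsNamed.exec_lift (h : IsNamed δ c' c) {s s'} (hs : StmtRealizes δ s s')
    (hd' : Exec s' c' d') (hd : ∃ d, Exec s c d) : ∃ d, Exec s c d ∧ IsNamed δ d' d := by
  obtain ⟨d, hd⟩ := hd
  cases hs with
  | right i l' =>
    cases hd'
    refine ⟨_, rfl, ?_⟩
    rw [h.head]
    exact (h.setHead _ _).setLabel _
  | left i l' =>
    cases hd'
    refine ⟨_, rfl, ?_⟩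
    rw [h.head]
    exact (h.setHead _ _).setLabel _
  | write i a l' =>
    cases hd'
    exact ⟨_, rfl, (h.setCell (.inr rfl)).setLabel _⟩
  | test i a l' l'' =>
    have hiff : c'.scanned i = .inr a ↔ c.scanned i = .inr a := by
      have hi := h.scanned i
      generalize c'.scanned i = s at hi ⊢
      generalize c.scanned i = s₁ at hi ⊢
      cases hi with
      | inl => simp
      | inr he => rw [he]; simp
    rcases hd' with ⟨ha, rfl⟩ | ⟨ha, rfl⟩
    · exact ⟨_, .inl ⟨hiff.1 ha, rfl⟩, h.setLabel _⟩
    · exact ⟨_, .inr ⟨fun h' => ha (hiff.2 h'), rfl⟩, h.setLabel _⟩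
  | assign i n idx f g l' hr =>
    obtain ⟨x, hx, y, hy, -⟩ := hd
    obtain ⟨x', hx', y', hy', rfl⟩ := hd'
    obtain ⟨x'', hx'', hxx⟩ := h.exists_inl hx
    obtain rfl : x'' = x' := funext fun j => Sum.inl_injective ((hx'' j).symm.trans (hx' j))
    obtain ⟨z, hz, hz'⟩ := (hr x'' x hxx ⟨y, hy⟩).2 y' hy'
    exact ⟨_, ⟨x, hx, z, hz, rfl⟩, (h.setCell (.inl hz')).setLabel _⟩
  | branch n idx f hf g hg l' l'' hr =>
    obtain ⟨x, hx, hv⟩ := hd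
    obtain ⟨x', hx', hv'⟩ := hd'
    obtain ⟨x'', hx'', hxx⟩ := h.exists_inl hx
    obtain rfl : x'' = x' := funext fun j => Sum.inl_injective ((hx'' j).symm.trans (hx' j))
    have hne : (toMulti f x).Nonempty := hv.elim (fun hv => ⟨_, hv.1⟩) fun hv => ⟨_, hv.1⟩
    rcases hv' with ⟨hv', rfl⟩ | ⟨hv', rfl⟩
    · obtain ⟨v, hv1, hv2⟩ := (hr x'' x hxx hne).2 _ hv'
      cases hv2
      exact ⟨_, ⟨x, hx, .inl ⟨hv1, rfl⟩⟩, h.setLabel _⟩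
    · obtain ⟨v, hv1, hv2⟩ := (hr x'' x hxx hne).2 _ hv'
      cases hv2
      exact ⟨_, ⟨x, hx, .inr ⟨hv1, rfl⟩⟩, h.setLabel _⟩

theorem IsNamed.step_lift (hs : ∀ l, StmtRealizes δ (P.stm l) (stm' l)) (h : IsNamed δ c' c)
    (hc : AllAccepting c) (hd' : Step c' d') : ∃ d, Step c d ∧ IsNamed δ d' d := by
  obtain ⟨label', tape', head'⟩ := c'
  obtain ⟨label, tape, head⟩ := c
  -- Identifying the labels lets both machines look up their statement at the same index.
  obtain rfl : label' = label := h.label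
  obtain ⟨hl, he⟩ := hd'
  obtain ⟨e, _, hce⟩ := hc.exists_step hl
  obtain ⟨d, hd, hdd⟩ := h.exec_lift (hs _) he ⟨e, hce⟩
  exact ⟨d, ⟨hl, hd⟩, hdd⟩

theorem IsNamed.exists_step (hs : ∀ l, StmtRealizes δ (P.stm l) (stm' l)) (h : IsNamed δ c' c)
    (hd : Step c d) : ∃ d', Step c' d' := by
  obtain ⟨label', tape', head'⟩ := c'
  obtain ⟨label, tape, head⟩ := c
  obtain rfl : label' = label := h.label
  obtain ⟨hl, he⟩ := hd
  obtain ⟨d', hd'⟩ := h.exists_exec (hs _) he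
  exact ⟨d', hl, hd'⟩

/-- The absence of infinite computations makes the successor relation well-founded below `c`.
Induction along it works since each step on names lifts to a step of the original machine. -/
theorem IsNamed.exists_result (hs : ∀ l, StmtRealizes δ (P.stm l) (stm' l)) (h : IsNamed δ c' c)
    (hc : AllAccepting c) :
    ∃ d', Relation.ReflTransGen Step c' d' ∧ d'.label = P.lf ∧ ∃ y, d'.tape 0 0 = .inl y := by
  have hacc : Acc (fun a b : P.Cfg => Step b a) c := by
    by_contra hn
    obtain ⟨s, h0, hstep⟩ := not_acc_iff_exists_descending_chain.1 hn
    exact hc.1 ⟨s, h0, hstep⟩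
  induction hacc generalizing c' with
  | intro c _ ih =>
    by_cases hl : c.label = P.lf
    · have hnot : ¬∃ d, Step c d := fun ⟨d, hd, _⟩ => hd hl
      obtain ⟨-, z, hz⟩ := hc.2 c .refl hnot
      refine ⟨c', .refl, h.label.trans hl, ?_⟩
      have h0 := h.tape 0 0
      rw [hz] at h0
      generalize c'.tape 0 0 = s at h0 ⊢
      cases h0 with
      | inl => exact ⟨_, rfl⟩
    · obtain ⟨e, he⟩ := hc.exists_step hl
      obtain ⟨e', he'⟩ := h.exists_step hs he
      obtain ⟨d, hd, hdd⟩ := h.step_lift hs hc he'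
      obtain ⟨d', hd', hr⟩ := ih d hd hdd (hc.step hd)
      exact ⟨d', .head he' hd', hr⟩

theorem IsNamed.reaches_lift (hs : ∀ l, StmtRealizes δ (P.stm l) (stm' l)) (h : IsNamed δ c' c)
    (hc : AllAccepting c) (hd' : Relation.ReflTransGen Step c' d') :
    ∃ d, Relation.ReflTransGen Step c d ∧ IsNamed δ d' d := by
  induction hd' using Relation.ReflTransGen.head_induction_on generalizing c with
  | refl => exact ⟨c, .refl, h⟩
  | head h1 _ ih =>
    obtain ⟨e, he, hn⟩ := h.step_lift hs hc h1
    obtain ⟨d, hd, hdn⟩ := ih hn (hc.step he)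
    exact ⟨d, .head he hd, hdn⟩

theorem isNamed_init {x' : ∀ j, Names A (κ (P.inTape j))} {x : ∀ j, P.X (P.inTape j)}
    (h : ∀ j, x j ∈ δ (P.inTape j) (x' j)) :
    IsNamed δ (init (P := P.withStatements (fun i => Names A (κ i)) stm') x') (init x) := by
  refine ⟨rfl, rfl, fun i m => ?_⟩
  refine Fin.cases ?_ (fun i => ?_) i
  · exact .inr rfl
  · simp only [init, Fin.cases_succ]
    by_cases hi : i.val < P.k ∧ m = 0
    · simp only [hi, and_self, dite_true]
      exact .inl (h ⟨i.val, hi.1⟩)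
    · rw [dif_neg hi, dif_neg hi]
      exact .inr rfl

theorem realizes_results (hs : ∀ l, StmtRealizes δ (P.stm l) (stm' l)) :
    Realizes (fun j => δ (P.inTape j)) (δ 0)
      (results (P.withStatements (fun i => Names A (κ i)) stm')) P.fn := by
  rintro x' x hx ⟨_, hc, -⟩
  have h := isNamed_init (stm' := stm') hx
  constructor
  · obtain ⟨d', hd', hl, y, hy⟩ := h.exists_result hs hc
    exact ⟨y, d', hd', hl, hy⟩
  · rintro y ⟨d', hd', hl, hy⟩
    obtain ⟨d, hd, hdn⟩ := h.reaches_lift hs hc hd'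
    have hacc := hc.2 d hd fun ⟨e, he, _⟩ => he (hdn.label.symm.trans hl)
    have h0 := hdn.tape 0 0
    obtain ⟨z, hz⟩ := hacc.2
    rw [hy, hz] at h0
    exact ⟨z, ⟨hc, d, hd, hacc, hz⟩, by cases h0; assumption⟩

end GTM

end Realization

end

section

/-! ## Running a generalized Turing machine on approximations -/

/-- The empty list asserts nothing and is always correct, so it may stand in for an approximation at
stages before some bound. -/
theorem Conv.of_eventually_eq {A : Type*} {κ₁ : NameKind} {a a' : ℕ → Approx A} {y : Names A κ₁}
    (h : Conv a y) (h' : ∀ t, a' t = a t ∨ a' t = []) (hT : ∃ T, ∀ t ≥ T, a' t = a t) :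
    Conv a' y := by
  refine ⟨fun t m v hv => ?_, fun m => ?_⟩
  · rcases h' t with e | e
    · exact h.1 t m v (e ▸ hv)
    · simp [e] at hv
  · obtain ⟨T, hT⟩ := hT
    obtain ⟨T', hT'⟩ := h.2 m
    exact ⟨max T T', fun t ht => by
      rw [hT t (le_of_max_le_left ht)]; exact hT' t (le_of_max_le_right ht)⟩

theorem lookup_ofFn {α β : Type*} [DecidableEq α] {n : ℕ} {key : Fin n → α}
    (hk : Function.Injective key) (val : Fin n → β) (j : Fin n) :
    (List.ofFn fun j => (key j, val j)).lookup (key j) = some (val j) := by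
  rcases ho : (List.ofFn fun j => (key j, val j)).lookup (key j) with _ | v
  · rw [List.lookup_eq_none_iff] at ho
    have := ho (key j, val j) (List.mem_ofFn.2 ⟨j, rfl⟩)
    simp at this
  · obtain ⟨l₁, l₂, hl, -⟩ := List.lookup_eq_some_iff.1 ho
    have hm : (key j, v) ∈ List.ofFn fun j => (key j, val j) := by
      rw [hl]; simp
    obtain ⟨j', hj'⟩ := List.mem_ofFn.1 hm
    obtain ⟨h1, rfl⟩ := Prod.mk.inj hj'
    rw [hk h1]

theorem lookup_ofFn_eq_none {α β : Type*} [DecidableEq α] {n : ℕ} {key : Fin n → α}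
    {val : Fin n → β} {p : α} (h : ∀ j, key j ≠ p) :
    (List.ofFn fun j => (key j, val j)).lookup p = none := by
  rw [List.lookup_eq_none_iff]
  intro q hq
  obtain ⟨j, rfl⟩ := List.mem_ofFn.1 hq
  simpa using (h j).symm

/-- Statements of generalized Turing machines that operate on approximations. -/
inductive ApproxStmt (A : Type*) (Lab Γ : Type) (N : ℕ)
  | right (i : Fin N) (l' : Lab)
  | left (i : Fin N) (l' : Lab)
  | write (i : Fin N) (a : Γ) (l' : Lab)
  | test (i : Fin N) (a : Γ) (l' l'' : Lab)
  | assign (i : Fin N) (n : ℕ) (idx : Fin n → Fin N)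
      (h : ℕ → (Fin n → Approx A) → Approx A) (l' : Lab)
  | branch (n : ℕ) (idx : Fin n → Fin N)
      (h : ℕ → (Fin n → Approx A) → Approx A) (l' l'' : Lab)

/-- All functions in the statement satisfy `C`. -/
def ApproxStmt.All {A : Type*} (C : ∀ n, (ℕ → (Fin n → Approx A) → Approx A) → Prop)
    {Lab Γ : Type} {N : ℕ} : ApproxStmt A Lab Γ N → Prop
  | .assign _ n _ h _ => C n h
  | .branch n _ h _ _ => C n h
  | _ => True

/-- A label, the head positions, and a list of the performed write operations (the latest one
first). -/
abbrev ApproxCfg (A : Type*) (Lab Γ : Type) (N : ℕ) :=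
  Lab × (Fin N → ℤ) × List ((Fin N × ℤ) × (Approx A ⊕ Γ))

namespace ApproxCfg

variable {A : Type*} {Lab Γ : Type} {N : ℕ}

/-- The content of a cell, where `b` is the blank. -/
def read (b : Γ) (c : ApproxCfg A Lab Γ N) (p : Fin N × ℤ) : Approx A ⊕ Γ :=
  (@List.lookup _ _ instBEqOfDecidableEq p c.2.2).getD (.inr b)

/-- The approximation in a cell; it is empty if the cell contains an element of `Γ`. -/
def readApprox (b : Γ) (c : ApproxCfg A Lab Γ N) (p : Fin N × ℤ) : Approx A :=
  (c.read b p).elim id fun _ => []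

/-- The approximations under the heads of the tapes `idx j`. -/
def args (b : Γ) (c : ApproxCfg A Lab Γ N) {n : ℕ} (idx : Fin n → Fin N) : Fin n → Approx A :=
  fun j => c.readApprox b (idx j, c.2.1 (idx j))

/-- Write under the head of tape `i` and change the label. -/
def write (c : ApproxCfg A Lab Γ N) (i : Fin N) (v : Approx A ⊕ Γ) (l : Lab) :
    ApproxCfg A Lab Γ N :=
  (l, c.2.1, ((i, c.2.1 i), v) :: c.2.2)

theorem read_write (b : Γ) (c : ApproxCfg A Lab Γ N) (i : Fin N) (v : Approx A ⊕ Γ) (l : Lab)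
    (p : Fin N × ℤ) : (c.write i v l).read b p = if p = (i, c.2.1 i) then v else c.read b p := by
  unfold read write
  by_cases h : p = (i, c.2.1 i)
  · simp [h]
  · have h' : (@BEq.beq _ instBEqOfDecidableEq p (i, c.2.1 i)) = false := by simpa using h
    simp [List.lookup_cons, h', h]

end ApproxCfg

open Classical in
/-- The effect of a statement at stage `t`. A branching whose condition is not yet determined at
stage `t` has no effect. -/
noncomputable def ApproxStmt.exec {A : Type*} [Zero A] [One A] {Lab Γ : Type} {N : ℕ} (b : Γ)
    (t : ℕ) : ApproxStmt A Lab Γ N → ApproxCfg A Lab Γ N → ApproxCfg A Lab Γ N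
  | .right i l', c => (l', Function.update c.2.1 i (c.2.1 i + 1), c.2.2)
  | .left i l', c => (l', Function.update c.2.1 i (c.2.1 i - 1), c.2.2)
  | .write i a l', c => c.write i (.inr a) l'
  | .test i a l' l'', c => (if c.read b (i, c.2.1 i) = .inr a then l' else l'', c.2)
  | .assign i _ idx h l', c => c.write i (.inl (h t (c.args b idx))) l'
  | .branch _ idx h l' l'', c =>
      if (h t (c.args b idx))[0]? = some (some 0) then (l', c.2)
      else if (h t (c.args b idx))[0]? = some (some 1) then (l'', c.2) else c

/-- The functions in the first statement are tracked by those in the second one. -/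
inductive StmtTracks {A : Type*} [Zero A] [One A] {Lab Γ : Type} {L : ℕ}
    {κ : Fin (L + 1) → NameKind} :
    Stmt A Lab Γ (fun i => Names A (κ i)) → ApproxStmt A Lab Γ (L + 1) → Prop
  | right (i l') : StmtTracks (.right i l') (.right i l')
  | left (i l') : StmtTracks (.left i l') (.left i l')
  | write (i a l') : StmtTracks (.write i a l') (.write i a l')
  | test (i a l' l'') : StmtTracks (.test i a l' l'') (.test i a l' l'')
  | assign (i n idx f h l') (hh : Tracks (κ := fun j => κ (idx j)) h f) :
      StmtTracks (.assign i n idx f l') (.assign i n idx h l')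
  | branch (n idx f hf h l' l'')
      (hh : Tracks (κ := fun j => κ (idx j)) (κ₀ := .word) h (toMulti f)) :
      StmtTracks (.branch n idx f hf l' l'') (.branch n idx h l' l'')

/-- Convergence of contents of a cell. -/
def ConvCell {A Γ : Type*} {κ₁ : NameKind} (u : ℕ → Approx A ⊕ Γ) : Names A κ₁ ⊕ Γ → Prop
  | .inl y => ∃ a : ℕ → Approx A, (∀ t, u t = .inl (a t)) ∧ Conv a y
  | .inr g => ∀ t, u t = .inr g

namespace GTM

variable {A : Type*} [Zero A] [One A] {P : GTM A} {κ : Fin (P.L + 1) → NameKind}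
  {stm' : {l : P.Lab // l ≠ P.lf} → Stmt A P.Lab P.Γ fun i => Names A (κ i)}

/-- Convergence of configurations. -/
structure ConvCfg (E : ℕ → ApproxCfg A P.Lab P.Γ (P.L + 1))
    (c : (P.withStatements (fun i => Names A (κ i)) stm').Cfg) : Prop where
  label : ∀ t, (E t).1 = c.label
  head : ∀ t, (E t).2.1 = c.head
  tape : ∀ i m, ConvCell (fun t => (E t).read P.b (i, m)) (c.tape i m)

variable {E : ℕ → ApproxCfg A P.Lab P.Γ (P.L + 1)}
  {c d : (P.withStatements (fun i => Names A (κ i)) stm').Cfg}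

theorem ConvCfg.setLabel (h : ConvCfg E c) (l : P.Lab) :
    ConvCfg (fun t => (l, (E t).2)) (c.setLabel l) :=
  ⟨fun _ => rfl, h.head, h.tape⟩

theorem ConvCfg.setHead (h : ConvCfg E c) (i : Fin (P.L + 1)) (g : ℤ → ℤ) (l : P.Lab) :
    ConvCfg (fun t => (l, Function.update (E t).2.1 i (g ((E t).2.1 i)), (E t).2.2))
      ((c.setHead i (g (c.head i))).setLabel l) :=
  ⟨fun _ => rfl, fun t => by simp only [Cfg.setHead, Cfg.setLabel, h.head], h.tape⟩

theorem ConvCfg.write (h : ConvCfg E c) {i : Fin (P.L + 1)} {u : ℕ → Approx A ⊕ P.Γ}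
    {v : Names A (κ i) ⊕ P.Γ} (hu : ConvCell u v) (l : P.Lab) :
    ConvCfg (fun t => (E t).write i (u t) l) ((c.setCell i v).setLabel l) := by
  refine ⟨fun _ => rfl, h.head, fun k m => ?_⟩
  simp only [ApproxCfg.read_write, Cfg.setCell, Cfg.setLabel, h.head, Prod.mk.injEq]
  by_cases hk : k = i
  · subst hk
    simp only [Function.update_self, true_and]
    by_cases hm : m = c.head k
    · subst hm; simpa only [Function.update_self, if_true] using hu
    · simpa only [Function.update_of_ne hm, if_neg hm] using h.tape k m
  · simpa only [Function.update_of_ne hk, hk, false_and, if_false] using h.tape k m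

theorem ConvCfg.args (h : ConvCfg E c) {n : ℕ} {idx : Fin n → Fin (P.L + 1)}
    {x : ∀ j, Names A (κ (idx j))} (hx : ∀ j, c.scanned (idx j) = .inl (x j)) (j : Fin n) :
    Conv (fun t => (E t).args P.b idx j) (x j) := by
  have hj := h.tape (idx j) (c.head (idx j))
  rw [show c.tape (idx j) (c.head (idx j)) = _ from hx j] at hj
  obtain ⟨a, ha, hc⟩ := hj
  convert hc using 2 with t
  have hat : (E t).read P.b (idx j, c.head (idx j)) = .inl (a t) := ha t
  rw [ApproxCfg.args, ApproxCfg.readApprox, h.head, hat]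
  rfl

/-- Only a branching can fail to be executed at an early stage, and it then leaves the configuration
unchanged. The other statements act on labels, heads and elements of `Γ`, which are known exactly,
or write an approximation that converges because the assigned function is tracked. -/
theorem ConvCfg.exec (h01 : (0 : A) ≠ 1) (h : ConvCfg E c)
    {s : Stmt A P.Lab P.Γ fun i => Names A (κ i)} {s' : ApproxStmt A P.Lab P.Γ (P.L + 1)}
    (hs : StmtTracks s s') (hd : Exec s c d) :
    ∃ E', ConvCfg E' d ∧ (∀ t, s'.exec P.b t (E t) = E' t ∨ s'.exec P.b t (E t) = E t) ∧
      ∃ T, ∀ t ≥ T, s'.exec P.b t (E t) = E' t := by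
  have det : ∀ {E'}, (∀ t, s'.exec P.b t (E t) = E' t) → ConvCfg E' d →
      ∃ E', ConvCfg E' d ∧ (∀ t, s'.exec P.b t (E t) = E' t ∨ s'.exec P.b t (E t) = E t) ∧
      ∃ T, ∀ t ≥ T, s'.exec P.b t (E t) = E' t :=
    fun {E'} h1 h2 => ⟨E', h2, fun t => .inl (h1 t), 0, fun t _ => h1 t⟩
  cases hs with
  | right i l' =>
    cases hd
    exact det (fun t => rfl) (h.setHead i (· + 1) l')
  | left i l' =>
    cases hd
    exact det (fun t => rfl) (h.setHead i (· - 1) l')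
  | write i a l' =>
    cases hd
    exact det (fun t => rfl) (h.write (u := fun _ => .inr a) (v := .inr a) (fun _ => rfl) l')
  | test i a l' l'' =>
    have hiff : ∀ t, (E t).read P.b (i, (E t).2.1 i) = .inr a ↔ c.scanned i = .inr a := by
      intro t
      have ht := h.tape i (c.head i)
      rw [h.head, Cfg.scanned]
      generalize c.tape i (c.head i) = u at ht ⊢
      cases u with
      | inl u =>
        obtain ⟨a, ha, -⟩ := ht
        simp [ha t]
      | inr g => simp [ht t]
    rcases hd with ⟨ha, rfl⟩ | ⟨ha, rfl⟩
    · exact det (fun t => by simp only [ApproxStmt.exec]; rw [if_pos ((hiff t).2 ha)])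
        (h.setLabel l')
    · exact det (fun t => by simp only [ApproxStmt.exec]; rw [if_neg (ha ∘ (hiff t).1)])
        (h.setLabel l'')
  | assign i n idx f g l' hh =>
    obtain ⟨x, hx, y, hy, rfl⟩ := hd
    have := hh x y hy (fun t => (E t).args P.b idx) (h.args hx)
    exact det (fun t => rfl) (h.write (u := fun t => .inl (g t ((E t).args P.b idx))) (v := .inl y)
      ⟨_, fun _ => rfl, this⟩ l')
  | branch n idx f hf g l' l'' hh =>
    obtain ⟨x, hx, hv⟩ := hd
    have key : ∀ v, v ∈ f x → Conv (fun t => g t ((E t).args P.b idx)) (κ := .word) v :=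
      fun v hv => hh x v hv (fun t => (E t).args P.b idx) (h.args hx)
    simp only [ApproxStmt.exec]
    rcases hv with ⟨hv, rfl⟩ | ⟨hv, rfl⟩
    · have hc := key _ hv
      refine ⟨_, h.setLabel l', fun t => ?_, ?_⟩
      · split_ifs with h1 h2
        · exact .inl rfl
        · exact absurd (hc.1 t 0 _ h2) (by simpa [Names.cell] using h01)
        · exact .inr rfl
      · obtain ⟨T, hT⟩ := hc.getElem? 0
        exact ⟨T, fun t ht => if_pos (hT t ht)⟩
    · have hc := key _ hv
      refine ⟨_, h.setLabel l'', fun t => ?_, ?_⟩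
      · split_ifs with h1 h2
        · exact absurd (hc.1 t 0 _ h1) (by simpa [Names.cell] using h01.symm)
        · exact .inl rfl
        · exact .inr rfl
      · obtain ⟨T, hT⟩ := hc.getElem? 0
        refine ⟨T, fun t ht => ?_⟩
        have h1 : (g t ((E t).args P.b idx))[0]? = some (some 1) := hT t ht
        rw [if_neg (by rw [h1]; simpa using h01.symm), if_pos h1]

variable (P) in
/-- The initial configuration for given approximations of the inputs. -/
def approxInit (a : Fin P.k → Approx A) : ApproxCfg A P.Lab P.Γ (P.L + 1) :=
  (P.l₀, fun _ => 0, List.ofFn fun j => ((P.inTape j, 0), .inl (a j)))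

theorem inTape_injective : Function.Injective P.inTape := fun i j h => by
  simpa [inTape, Fin.ext_iff] using h

theorem approxInit_read_inTape (a : Fin P.k → Approx A) (j : Fin P.k) :
    (P.approxInit a).read P.b (P.inTape j, 0) = .inl (a j) := by
  unfold ApproxCfg.read approxInit
  rw [lookup_ofFn (key := fun j => (P.inTape j, (0 : ℤ)))
    fun _ _ h => inTape_injective (Prod.mk.inj h).1]
  rfl

theorem approxInit_read_of_forall_ne (a : Fin P.k → Approx A) {i : Fin (P.L + 1)} {m : ℤ}
    (h : ∀ j, ¬(P.inTape j = i ∧ m = 0)) : (P.approxInit a).read P.b (i, m) = .inr P.b := by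
  unfold ApproxCfg.read approxInit
  rw [lookup_ofFn_eq_none (key := fun j => (P.inTape j, (0 : ℤ)))
    fun j hj => h j ⟨(Prod.mk.inj hj).1, (Prod.mk.inj hj).2.symm⟩]
  rfl

theorem convCfg_init {a : ℕ → Fin P.k → Approx A} {x : ∀ j, Names A (κ (P.inTape j))}
    (h : ∀ j, Conv (fun t => a t j) (x j)) :
    ConvCfg (fun t => P.approxInit (a t))
      (init (P := P.withStatements (fun i => Names A (κ i)) stm') x) := by
  refine ⟨fun _ => rfl, fun _ => rfl, fun i m => ?_⟩
  induction i using Fin.cases with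
  | zero =>
    intro t
    exact approxInit_read_of_forall_ne _ fun j hj => Fin.succ_ne_zero _ hj.1
  | succ i =>
    simp only [init, Fin.cases_succ]
    by_cases hi : i.val < P.k ∧ m = 0
    · obtain ⟨hi, rfl⟩ := hi
      rw [dif_pos ⟨hi, rfl⟩]
      exact ⟨fun t => a t ⟨i, hi⟩, fun t => approxInit_read_inTape (a t) ⟨i, hi⟩, h ⟨i, hi⟩⟩
    · rw [dif_neg hi]
      refine fun t => approxInit_read_of_forall_ne _ fun j hj => hi ⟨?_, hj.2⟩
      have := congrArg Fin.val hj.1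
      simp only [inTape, Fin.val_succ, Fin.val_castLE] at this
      omega

/-! ### The bounded run at a given stage and its correctness -/

variable (P) (hs : {l : P.Lab // l ≠ P.lf} → ApproxStmt A P.Lab P.Γ (P.L + 1))

open Classical in
/-- One step at stage `t`. -/
noncomputable def approxStep (t : ℕ) (c : ApproxCfg A P.Lab P.Γ (P.L + 1)) :
    ApproxCfg A P.Lab P.Γ (P.L + 1) :=
  if h : c.1 ≠ P.lf then (hs ⟨c.1, h⟩).exec P.b t c else c

open Classical in
/-- The approximation of the result at stage `t`. -/
noncomputable def approxResult (t : ℕ) (a : Fin P.k → Approx A) : Approx A :=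
  if ((P.approxStep hs t)^[t] (P.approxInit a)).1 = P.lf then
    ((P.approxStep hs t)^[t] (P.approxInit a)).readApprox P.b (0, 0) else []

variable {P hs}

theorem approxStep_of_eq {t : ℕ} {c : ApproxCfg A P.Lab P.Γ (P.L + 1)} (h : c.1 = P.lf) :
    P.approxStep hs t c = c := by
  simp [approxStep, h]

theorem iterate_of_fixed {α : Type*} {f : α → α} {x : α} {s s' : ℕ} (hs : s ≤ s')
    (h : f (f^[s] x) = f^[s] x) : f^[s'] x = f^[s] x := by
  obtain ⟨d, rfl⟩ := Nat.exists_eq_add_of_le' hs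
  rw [Function.iterate_add_apply, Function.iterate_fixed h]

/-- At each stage the run either follows the given computation for its `N` steps or freezes at an
undetermined branching. A frozen configuration is a fixed point with a non-final label, so that
stage never yields a result. As there are finitely many branchings on the way, all of them are
determined at late stages. -/
theorem exists_convCfg (h01 : (0 : A) ≠ 1) (hst : ∀ l, StmtTracks (stm' l) (hs l))
    {a : ℕ → Fin P.k → Approx A} {x : ∀ j, Names A (κ (P.inTape j))}
    (h : ∀ j, Conv (fun t => a t j) (x j))
    {d : (P.withStatements (fun i => Names A (κ i)) stm').Cfg}
    (hd : Relation.ReflTransGen Step (init x) d) :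
    ∃ (N : ℕ) (E : ℕ → _), ConvCfg E d ∧
      (∀ t, (∀ s, ((P.approxStep hs t)^[s] (P.approxInit (a t))).1 ≠ P.lf) ∨
        (P.approxStep hs t)^[N] (P.approxInit (a t)) = E t) ∧
      ∃ T, ∀ t ≥ T, (P.approxStep hs t)^[N] (P.approxInit (a t)) = E t := by
  induction hd with
  | refl => exact ⟨0, _, convCfg_init h, fun t => .inr rfl, 0, fun t _ => rfl⟩
  | @tail c d _ hcd ih =>
    obtain ⟨N, E, hE, h1, T, hT⟩ := ih
    obtain ⟨hl, he⟩ := hcd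
    have hstep : ∀ t, P.approxStep hs t (E t) = (hs ⟨c.label, hl⟩).exec P.b t (E t) := by
      intro t
      have hlt := hE.label t
      have hne : (E t).1 ≠ P.lf := by rw [hlt]; exact hl
      rw [approxStep, dif_pos hne]
      congr 3
    obtain ⟨E', hE', h2, T', hT'⟩ := hE.exec h01 (hst _) he
    refine ⟨N + 1, E', hE', fun t => ?_, max T T', fun t ht => ?_⟩
    · rcases h1 t with h1 | h1
      · exact .inl h1
      · rcases h2 t with h2 | h2
        · right
          rw [Function.iterate_succ_apply', h1, hstep, h2]
        · left
          have hfix : P.approxStep hs t ((P.approxStep hs t)^[N] (P.approxInit (a t))) =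
              (P.approxStep hs t)^[N] (P.approxInit (a t)) := by
            rw [h1, hstep, h2]
          have hne : ((P.approxStep hs t)^[N] (P.approxInit (a t))).1 ≠ P.lf := by
            rw [h1, hE.label t]; exact hl
          intro s hs'
          -- After step `N` nothing changes. A final label before step `N` would also persist,
          -- contradicting the non-final label at `N`.
          rcases le_total N s with hNs | hNs
          · exact hne (by rw [← iterate_of_fixed hNs hfix]; exact hs')
          · exact hne (by rw [iterate_of_fixed hNs (approxStep_of_eq hs')]; exact hs')
    · rw [Function.iterate_succ_apply', hT t (le_of_max_le_left ht), hstep,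
        hT' t (le_of_max_le_right ht)]

theorem tracks_approxResult (h01 : (0 : A) ≠ 1) (hst : ∀ l, StmtTracks (stm' l) (hs l)) :
    Tracks (κ := fun j => κ (P.inTape j)) (κ₀ := κ 0) (P.approxResult hs)
      (results (P.withStatements (fun i => Names A (κ i)) stm')) := by
  rintro x y ⟨d, hd, hl, hy⟩ a ha
  obtain ⟨N, E, hE, h1, T, hT⟩ := exists_convCfg h01 hst ha hd
  have h0 := hE.tape 0 0
  rw [hy] at h0
  obtain ⟨u, hu, hconv⟩ := h0
  have hread : ∀ t, (E t).readApprox P.b (0, 0) = u t := fun t => by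
    have hut : (E t).read P.b (0, 0) = .inl (u t) := hu t
    rw [ApproxCfg.readApprox, hut]; rfl
  have hlf : ∀ t, (E t).1 = P.lf := fun t => (hE.label t).trans hl
  -- Stage `t` performs only `t` steps, so besides `T` the stage must reach the length `N` of the
  -- computation.
  refine hconv.of_eventually_eq (fun t => ?_) ⟨max T N, fun t ht => ?_⟩
  · unfold approxResult
    split_ifs with ht
    · left
      rw [← hread]
      rcases h1 t with h1 | h1
      · exact absurd ht (h1 t)
      -- Final configurations are fixed points, so the configurations after `t` and after `N` steps
      -- coincide whichever number is larger.
      · rcases le_total t N with htN | htN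
        · rw [← iterate_of_fixed htN (approxStep_of_eq ht), h1]
        · rw [iterate_of_fixed htN (approxStep_of_eq (by rw [h1, hlf])), h1]
    · exact .inr rfl
  · have hN := hT t (le_of_max_le_left ht)
    unfold approxResult
    rw [iterate_of_fixed (le_of_max_le_right ht) (approxStep_of_eq (by rw [hN, hlf])), hN,
      if_pos (hlf t), hread]

end GTM

end

section

/-! ## Primitive recursiveness -/

/-- Every finite type can be encoded. -/
@[reducible]
noncomputable def primcodableOfFinite (α : Type*) [Finite α] : Primcodable α :=
  Primcodable.ofEquiv (Fin (Nat.card α)) (Finite.equivFin α)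

section PrimrecLemmas

variable {α β σ : Type*} [Primcodable α] [Primcodable β] [Primcodable σ]

theorem primrec_pi {n : ℕ} {f : α → Fin n → σ} (h : ∀ i, Primrec fun a => f a i) : Primrec f :=
  Primrec.fin_curry.2 (Primrec₂.swap (Primrec.fin_curry₁.2 h))

theorem primrec_apply {n : ℕ} {f : α → Fin n → σ} (h : Primrec f) (i : Fin n) :
    Primrec fun a => f a i :=
  Primrec.fin_app.comp h (Primrec.const i)

/-- A case distinction over finitely many parameters needs no uniformity. It is used for labels and
for head movements. -/
theorem primrec_of_finite [Finite α] {f : α → β → σ} (h : ∀ a, Primrec (f a)) : Primrec₂ f := by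
  have h1 : Primrec₂ fun (i : Fin (Nat.card α)) b => f ((Finite.equivFin α).symm i) b :=
    Primrec.fin_curry₁.2 fun i => h _
  have h2 : Primrec (Finite.equivFin α) := Primrec.dom_finite _
  exact (h1.comp₂ (h2.comp₂ Primrec₂.left) Primrec₂.right).of_eq fun a b => by simp

theorem primrec_update {n : ℕ} {f : α → Fin n → σ} {g : α → σ} (hf : Primrec f) (hg : Primrec g)
    (i : Fin n) : Primrec fun a => Function.update (f a) i (g a) := by
  refine primrec_pi fun j => ?_
  by_cases h : j = i
  · subst h; simpa using hg
  · simpa [h] using primrec_apply hf j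

theorem encode_int_ofNat (n : ℕ) : Encodable.encode (n : ℤ) = 2 * n := rfl

theorem encode_int_negSucc (n : ℕ) : Encodable.encode (Int.negSucc n) = 2 * n + 1 := rfl

/-- Integers are encoded with `n ↦ 2n` and `-(n+1) ↦ 2n+1`. Adding one thus adds 2 to an even code
and subtracts 2 from an odd one, except that the code 1 of `-1` becomes the code 0 of `0`. -/
theorem primrec_int_succ : Primrec fun z : ℤ => z + 1 := by
  have h : Primrec fun n : ℕ => if n % 2 = 0 then n + 2 else if n = 1 then 0 else n - 2 :=
    Primrec.ite (Primrec.eq.comp (Primrec.nat_mod.comp Primrec.id (Primrec.const 2))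
      (Primrec.const 0)) (Primrec.nat_add.comp Primrec.id (Primrec.const 2))
      (Primrec.ite (Primrec.eq.comp Primrec.id (Primrec.const 1)) (Primrec.const 0)
        (Primrec.nat_sub.comp Primrec.id (Primrec.const 2)))
  refine Primrec.encode_iff.1 ((h.comp Primrec.encode).of_eq fun z => ?_)
  rcases z with n | n | n
  · have h1 := encode_int_ofNat n
    have h2 := encode_int_ofNat (n + 1)
    simp only [Int.ofNat_eq_natCast, h1]
    push_cast at h2
    rw [h2, if_pos (by omega)]
    ring
  · rfl
  · have h2 : Int.negSucc (n + 1) + 1 = Int.negSucc n := by omega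
    rw [h2, encode_int_negSucc, encode_int_negSucc, if_neg (by omega), if_neg (by omega)]
    omega

theorem primrec_int_pred : Primrec fun z : ℤ => z - 1 := by
  have h : Primrec fun n : ℕ => if n % 2 = 1 then n + 2 else if n = 0 then 1 else n - 2 :=
    Primrec.ite (Primrec.eq.comp (Primrec.nat_mod.comp Primrec.id (Primrec.const 2))
      (Primrec.const 1)) (Primrec.nat_add.comp Primrec.id (Primrec.const 2))
      (Primrec.ite (Primrec.eq.comp Primrec.id (Primrec.const 0)) (Primrec.const 1)
        (Primrec.nat_sub.comp Primrec.id (Primrec.const 2)))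
  refine Primrec.encode_iff.1 ((h.comp Primrec.encode).of_eq fun z => ?_)
  rcases z with (_ | n) | n
  · rfl
  · have h2 : Int.ofNat (n + 1) - 1 = (n : ℤ) := by simp
    have h3 : Encodable.encode (Int.ofNat (n + 1)) = 2 * (n + 1) := encode_int_ofNat (n + 1)
    rw [h2, h3, encode_int_ofNat, if_neg (by omega), if_neg (by omega)]
    omega
  · have h2 : Int.negSucc n - 1 = Int.negSucc (n + 1) := by omega
    rw [h2, encode_int_negSucc, encode_int_negSucc, if_pos (by omega)]
    ring

end PrimrecLemmas

variable {A : Type*} [Primcodable A] {Lab Γ : Type} [Primcodable Lab] [Primcodable Γ] {N : ℕ}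

theorem primrec_read (b : Γ) {α : Type*} [Primcodable α] {c : α → ApproxCfg A Lab Γ N}
    {p : α → Fin N × ℤ} (hc : Primrec c) (hp : Primrec p) :
    Primrec fun x => (c x).read b (p x) :=
  Primrec.option_getD.comp (Primrec.listLookup.comp hp (Primrec.snd.comp (Primrec.snd.comp hc)))
    (Primrec.const _)

theorem primrec_readApprox (b : Γ) {α : Type*} [Primcodable α] {c : α → ApproxCfg A Lab Γ N}
    {p : α → Fin N × ℤ} (hc : Primrec c) (hp : Primrec p) :
    Primrec fun x => (c x).readApprox b (p x) :=
  (Primrec.sumCasesOn (primrec_read b hc hp) Primrec₂.right (Primrec₂.const [])).of_eq fun x => by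
    unfold ApproxCfg.readApprox
    cases (c x).read b (p x) <;> rfl

theorem primrec_args (b : Γ) {n : ℕ} (idx : Fin n → Fin N) :
    Primrec fun c : ApproxCfg A Lab Γ N => c.args b idx :=
  primrec_pi fun j => primrec_readApprox b Primrec.id ((Primrec.const (idx j)).pair
    (primrec_apply (Primrec.fst.comp Primrec.snd) (idx j)))

theorem primrec_write {α : Type*} [Primcodable α] {c : α → ApproxCfg A Lab Γ N}
    {v : α → Approx A ⊕ Γ} (hc : Primrec c) (hv : Primrec v) (i : Fin N) (l : Lab) :
    Primrec fun x => (c x).write i (v x) l :=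
  (Primrec.const l).pair ((Primrec.fst.comp (Primrec.snd.comp hc)).pair
    (Primrec.list_cons.comp (((Primrec.const i).pair
      (primrec_apply (Primrec.fst.comp (Primrec.snd.comp hc)) i)).pair hv)
      (Primrec.snd.comp (Primrec.snd.comp hc))))

open Classical in
theorem primrec_exec [Zero A] [One A] (b : Γ) {s : ApproxStmt A Lab Γ N}
    (hs : s.All fun _ h => Primrec₂ h) :
    Primrec₂ fun t (c : ApproxCfg A Lab Γ N) => s.exec b t c := by
  have hc : Primrec fun p : ℕ × ApproxCfg A Lab Γ N => p.2 := Primrec.snd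
  have hh : Primrec fun p : ℕ × ApproxCfg A Lab Γ N => p.2.2.1 :=
    Primrec.fst.comp (Primrec.snd.comp hc)
  have hl : Primrec fun p : ℕ × ApproxCfg A Lab Γ N => p.2.2.2 :=
    Primrec.snd.comp (Primrec.snd.comp hc)
  cases s with
  | right i l' =>
    exact (Primrec.const l').pair
      ((primrec_update hh (primrec_int_succ.comp (primrec_apply hh i)) i).pair hl)
  | left i l' =>
    exact (Primrec.const l').pair
      ((primrec_update hh (primrec_int_pred.comp (primrec_apply hh i)) i).pair hl)
  | write i a l' => exact primrec_write hc (Primrec.const _) i l'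
  | test i a l' l'' =>
    refine Primrec.pair (Primrec.ite ?_ (Primrec.const l') (Primrec.const l''))
      (Primrec.snd.comp hc)
    exact PrimrecRel.comp Primrec.eq
      (primrec_read b hc ((Primrec.const i).pair (primrec_apply hh i))) (Primrec.const _)
  | assign i n idx h l' =>
    have hv := hs.comp Primrec.fst ((primrec_args b idx).comp hc)
    exact primrec_write hc (Primrec.sumInl.comp hv) i l'
  | branch n idx h l' l'' =>
    have hv := hs.comp Primrec.fst ((primrec_args b idx).comp hc)
    have h0 := Primrec.list_getElem?.comp hv (Primrec.const 0)
    exact Primrec.ite (Primrec.eq.comp h0 (Primrec.const _))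
      ((Primrec.const l').pair (Primrec.snd.comp hc))
      (Primrec.ite (Primrec.eq.comp h0 (Primrec.const _))
        ((Primrec.const l'').pair (Primrec.snd.comp hc)) hc)

open Classical in
-- The number of steps at stage `t` is `t`, so no unbounded search occurs. Configurations are finite
-- objects because the tapes are stored as lists of write operations.
theorem GTM.primrec_approxResult [Zero A] [One A] (P : GTM A)
    {hs : {l : P.Lab // l ≠ P.lf} → ApproxStmt A P.Lab P.Γ (P.L + 1)}
    [Primcodable P.Lab] [Primcodable P.Γ]
    (h : ∀ l, (hs l).All fun _ h => Primrec₂ h) : Primrec₂ (P.approxResult hs) := by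
  have := P.finLab
  have hstep : Primrec₂ (P.approxStep hs) := by
    have h1 : Primrec₂ fun (l : P.Lab) (p : ℕ × ApproxCfg A P.Lab P.Γ (P.L + 1)) =>
        if h : l ≠ P.lf then (hs ⟨l, h⟩).exec P.b p.1 p.2 else p.2 := by
      refine primrec_of_finite fun l => ?_
      by_cases hl : l = P.lf
      · simpa [hl] using Primrec.snd
      · simp only [ne_eq, hl, not_false_eq_true, dite_true]
        exact primrec_exec P.b (h ⟨l, hl⟩)
    refine (h1.comp (Primrec.fst.comp Primrec.snd) Primrec.id).of_eq fun p => ?_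
    unfold GTM.approxStep
    rfl
  have hinit : Primrec P.approxInit := by
    refine (Primrec.const _).pair ((Primrec.const _).pair (Primrec.list_ofFn fun j => ?_))
    exact (Primrec.const _).pair (Primrec.sumInl.comp (primrec_apply Primrec.id j))
  have hiter : Primrec fun p : ℕ × (Fin P.k → Approx A) =>
      (P.approxStep hs p.1)^[p.1] (P.approxInit p.2) :=
    Primrec.nat_iterate Primrec.fst (hinit.comp Primrec.snd)
      (hstep.comp₂ (Primrec.fst.comp₂ Primrec₂.left) Primrec₂.right)
  exact Primrec.ite (Primrec.eq.comp (Primrec.fst.comp hiter) (Primrec.const _))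
    (primrec_readApprox P.b hiter (Primrec.const _)) (Primrec.const [])

end

section

/-! ## Running a Type-2 machine on approximations -/

/-- A tape, given by lists of symbols to the left and to the right of the scanned symbol. -/
abbrev ListTape (S : Type) := List S × S × List S

namespace ListTape

variable {S : Type} [Inhabited S]

/-- The tape described by a list tape. -/
def toTape (T : ListTape S) : Turing.Tape S :=
  ⟨T.2.1, Turing.ListBlank.mk T.1, Turing.ListBlank.mk T.2.2⟩

/-- Write a symbol and move the head. -/
def writeMove (d : Option Turing.Dir) (s : S) (T : ListTape S) : ListTape S :=
  match d with
  | none => (T.1, s, T.2.2)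
  | some .left => (T.1.tail, T.1.headI, s :: T.2.2)
  | some .right => (s :: T.1, T.2.2.headI, T.2.2.tail)

theorem toTape_writeMove (d : Option Turing.Dir) (s : S) (T : ListTape S) :
    (T.writeMove d s).toTape = Type2Machine.moveWork d (T.toTape.write s) := by
  rcases d with _ | _ | _ <;> rfl

end ListTape

namespace Type2Machine

variable {A : Type*} {n : ℕ} (M : Type2Machine A n)

/-- Configurations with lists in place of tapes. -/
abbrev ListCfg := M.Q × (Fin n → ℕ) × (Fin M.w → ListTape M.S) × List A

variable {M}

/-- The configuration described by lists. -/
def ListCfg.toCfg (c : M.ListCfg) : M.Cfg :=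
  ⟨c.1, c.2.1, fun j => (c.2.2.1 j).toTape, c.2.2.2⟩

variable (M) in
/-- What determines the next action: the state, the contents of the scanned cells of the input
tapes, as far as they are known, and of the work tapes. -/
abbrev View := M.Q × (Fin n → Option (Option A)) × (Fin M.w → M.S)

/-- The view of a machine that runs on approximations. -/
def ListCfg.view (c : M.ListCfg) (a : Fin n → Approx A) : M.View :=
  (c.1, fun j => (a j)[c.2.1 j]?, fun j => (c.2.2.1 j).2.1)

open Classical in
/-- The next action; nothing changes if the scanned symbols are not known or the machine halts. -/
noncomputable def View.action (v : M.View) : Type2Action A n M.w M.Q M.S :=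
  (if ∀ j, (v.2.1 j).isSome then M.prog v.1 (fun j => (v.2.1 j).join) v.2.2 else none).getD
    ⟨v.1, fun _ => none, v.2.2, fun _ => none, none⟩

/-- The machine is known to halt. -/
def View.Halts (v : M.View) : Prop :=
  (∀ j, (v.2.1 j).isSome) ∧ M.prog v.1 (fun j => (v.2.1 j).join) v.2.2 = none

/-- One step on approximations of the inputs. -/
noncomputable def ListCfg.next (a : Fin n → Approx A) (c : M.ListCfg) : M.ListCfg :=
  ((c.view a).action.next, fun j => moveInput ((c.view a).action.inputMove j) (c.2.1 j),
    fun j => (c.2.2.1 j).writeMove ((c.view a).action.workMove j) ((c.view a).action.write j),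
    c.2.2.2 ++ (c.view a).action.out.toList)

variable (M) in
/-- The initial configuration. -/
def listInit : M.ListCfg := (M.start, fun _ => 0, fun _ => ([], default, []), [])

variable (M) in
open Classical in
/-- The approximation of the result after `t` steps. -/
noncomputable def approxOutput (t : ℕ) (a : Fin n → Approx A) : Approx A :=
  ((ListCfg.next a)^[t] M.listInit).2.2.2.map some ++
    if (((ListCfg.next a)^[t] M.listInit).view a).Halts then List.replicate t none else []

/-! ### Correctness of the run on approximations -/

section Correctness

variable {κ : Fin n → NameKind} {κ₀ : NameKind} {x : ∀ j, Names A (κ j)} {a : Fin n → Approx A}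
  {c : M.ListCfg}

theorem ListCfg.view_join (ha : ∀ j m v, (a j)[m]? = some v → (x j).cell m = v)
    (h : ∀ j, ((a j)[c.2.1 j]?).isSome) :
    (fun j => ((c.view a).2.1 j).join) = fun j => (x j).cell (c.toCfg.pos j) := by
  funext j
  obtain ⟨v, hv⟩ := Option.isSome_iff_exists.1 (h j)
  have e : (c.view a).2.1 j = some v := hv
  rw [e, show (x j).cell (c.toCfg.pos j) = v from ha j _ v hv]
  rfl

/-- When all scanned input cells are known, the simulated view agrees with the true one, so the
simulation performs a true step or detects halting. -/
theorem ListCfg.step_toCfg (ha : ∀ j m v, (a j)[m]? = some v → (x j).cell m = v)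
    (h : ∀ j, ((a j)[c.2.1 j]?).isSome) :
    M.step x c.toCfg = none ∧ (c.view a).Halts ∨
      M.step x c.toCfg = some (c.next a).toCfg := by
  have hj := view_join ha h
  have h' : ∀ j, ((c.view a).2.1 j).isSome := h
  rcases ho : M.prog c.1 (fun j => ((c.view a).2.1 j).join) (fun j => (c.2.2.1 j).2.1) with _ | α
  · left
    refine ⟨?_, h', ho⟩
    rw [hj] at ho
    simp only [Type2Machine.step, Option.map_eq_none_iff]
    exact ho
  · right
    have hα : (c.view a).action = α := by
      rw [View.action, if_pos h']
      exact congrArg (fun o => Option.getD o _) ho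
    rw [hj] at ho
    have hs : M.step x c.toCfg = _ := congrArg (Option.map _) ho
    rw [hs]
    simp only [Option.map_some, ListCfg.toCfg, ListCfg.next, hα, ListTape.toTape_writeMove]

theorem ListCfg.next_of_not (h : ¬∀ j, ((a j)[c.2.1 j]?).isSome) :
    (c.next a).toCfg = c.toCfg := by
  have h' : ¬∀ j, ((c.view a).2.1 j).isSome := h
  have hα : (c.view a).action = ⟨c.1, fun _ => none, (c.view a).2.2, fun _ => none, none⟩ := by
    rw [View.action, if_neg h']
    rfl
  simp only [ListCfg.next, hα, Option.toList_none, List.append_nil]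
  rfl

theorem ListCfg.next_of_halts (h : (c.view a).Halts) : c.next a = c := by
  have hα : (c.view a).action = ⟨c.1, fun _ => none, (c.view a).2.2, fun _ => none, none⟩ := by
    rw [View.action, if_pos h.1, h.2]
    rfl
  simp only [ListCfg.next, hα, Option.toList_none, List.append_nil]
  rfl

/-- With correct approximations a simulated step is either a true step or a pause. Hence whatever
the simulation has written was written by the true machine. -/
theorem ListCfg.reaches_next (ha : ∀ j m v, (a j)[m]? = some v → (x j).cell m = v) :
    StateTransition.Reaches (M.step x) c.toCfg (c.next a).toCfg := by
  by_cases h : ∀ j, ((a j)[c.2.1 j]?).isSome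
  · rcases step_toCfg ha h with ⟨-, h⟩ | h
    · rw [next_of_halts h]; exact .refl
    · exact .single h
  · rw [next_of_not h]; exact .refl

theorem ListCfg.reaches_iterate (ha : ∀ j m v, (a j)[m]? = some v → (x j).cell m = v) (s : ℕ) :
    StateTransition.Reaches (M.step x) c.toCfg (((ListCfg.next a)^[s] c).toCfg) := by
  induction s with
  | zero => exact .refl
  | succ s ih =>
    rw [Function.iterate_succ_apply']
    exact ih.trans (reaches_next ha)

theorem output_prefix {c d : M.Cfg} (h : StateTransition.Reaches (M.step x) c d) :
    c.output <+: d.output := by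
  induction h with
  | refl => exact List.prefix_rfl
  | tail _ h ih =>
    refine ih.trans ?_
    obtain ⟨α, -, rfl⟩ := Option.map_eq_some_iff.1 h
    exact List.prefix_append _ _

theorem eq_of_reaches_of_step_eq_none {c d : M.Cfg} (h : StateTransition.Reaches (M.step x) c d)
    (hc : M.step x c = none) : d = c := by
  induction h using Relation.ReflTransGen.head_induction_on with
  | refl => rfl
  | head h => rw [hc] at h; cases h

/-- By determinism two reachable configurations are comparable, and the one-way output only grows;
so a symbol written once is a symbol of the result. -/
theorem Computes.cell_eq {y : Names A κ₀} (h : M.Computes x y) {c : M.Cfg}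
    (hc : StateTransition.Reaches (M.step x) M.init c) {m : ℕ} {v : A}
    (hv : c.output[m]? = some v) : y.cell m = some v := by
  cases κ₀ with
  | word =>
    obtain ⟨d, hd, hd0, rfl⟩ := h
    have hcd : StateTransition.Reaches (M.step x) c d := by
      rcases StateTransition.reaches_total hc hd with h | h
      · exact h
      · rw [eq_of_reaches_of_step_eq_none h hd0]; exact .refl
    obtain ⟨r, hr⟩ := output_prefix hcd
    change d.output[m]? = some v
    rw [← hr, List.getElem?_append_left (List.getElem?_eq_some_iff.1 hv).1, hv]
  | seq =>
    obtain ⟨d, hd, hdm⟩ := h m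
    change some (y m) = some v
    rw [← hdm]
    rcases StateTransition.reaches_total hc hd with h | h
    · obtain ⟨r, hr⟩ := output_prefix h
      rw [← hr, List.getElem?_append_left (List.getElem?_eq_some_iff.1 hv).1, hv]
    · obtain ⟨r, hr⟩ := output_prefix h
      rw [← hv, ← hr, List.getElem?_append_left (List.getElem?_eq_some_iff.1 hdm).1]

/-- A halting configuration is the last one, so its output is complete. This justifies the blanks
that `approxOutput` appends once halting is known. -/
theorem Computes.cell_eq_of_step_eq_none {y : Names A κ₀} (h : M.Computes x y) {c : M.Cfg}
    (hc : StateTransition.Reaches (M.step x) M.init c) (hc0 : M.step x c = none) (m : ℕ) :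
    y.cell m = c.output[m]? := by
  cases κ₀ with
  | word =>
    obtain ⟨d, hd, hd0, rfl⟩ := h
    have hcd : d = c := by
      rcases StateTransition.reaches_total hc hd with h | h
      · exact eq_of_reaches_of_step_eq_none h hc0
      · exact (eq_of_reaches_of_step_eq_none h hd0).symm
    subst hcd
    rfl
  | seq =>
    obtain ⟨d, hd, hdm⟩ := h m
    have hdc : StateTransition.Reaches (M.step x) d c := by
      rcases StateTransition.reaches_total hc hd with h | h
      · rw [eq_of_reaches_of_step_eq_none h hc0]; exact .refl
      · exact h
    obtain ⟨r, hr⟩ := output_prefix hdc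
    rw [← hr, List.getElem?_append_left (List.getElem?_eq_some_iff.1 hdm).1, hdm]
    rfl

theorem eventually_reads {a : ℕ → Fin n → Approx A} (ha : ∀ j, Conv (fun t => a t j) (x j))
    (pos : Fin n → ℕ) : ∃ T, ∀ t ≥ T, ∀ j, ((a t j)[pos j]?).isSome := by
  have := fun j => (ha j).2 (pos j)
  choose T hT using this
  refine ⟨Finset.univ.sup T, fun t ht j => ?_⟩
  rw [List.getElem?_eq_getElem (hT j t ((Finset.le_sup (Finset.mem_univ j)).trans ht))]
  rfl

/-- A finite computation reads finitely many input cells, all of which are known at late stages. -/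
theorem eventually_iterate_eq {a : ℕ → Fin n → Approx A} (ha : ∀ j, Conv (fun t => a t j) (x j))
    {d : M.Cfg} (hd : StateTransition.Reaches (M.step x) M.init d) :
    ∃ N T, ∀ t ≥ T, ((ListCfg.next (a t))^[N] M.listInit).toCfg = d := by
  induction hd with
  | refl => exact ⟨0, 0, fun t _ => rfl⟩
  | @tail c d _ hcd ih =>
    obtain ⟨N, T, hT⟩ := ih
    obtain ⟨T', hT'⟩ := eventually_reads ha c.pos
    refine ⟨N + 1, max T T', fun t ht => ?_⟩
    have h1 := hT t (le_of_max_le_left ht)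
    have h2 : ∀ j, ((a t j)[((ListCfg.next (a t))^[N] M.listInit).2.1 j]?).isSome := by
      have := hT' t (le_of_max_le_right ht)
      rw [← h1] at this
      exact this
    rw [Function.iterate_succ_apply']
    have hcd' : M.step x c = some d := hcd
    rcases ListCfg.step_toCfg (fun j => (ha j).1 t) h2 with ⟨h3, -⟩ | h3
    · rw [h1, hcd'] at h3; cases h3
    · rw [h1, hcd'] at h3
      exact (Option.some.inj h3).symm

theorem tracks_approxOutput :
    Tracks M.approxOutput fun x : ∀ j, Names A (κ j) => {y : Names A κ₀ | M.Computes x y} := by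
  intro x y hy a ha
  have hreach : ∀ t s, StateTransition.Reaches (M.step x) M.init
      (((ListCfg.next (a t))^[s] M.listInit).toCfg) :=
    fun t s => ListCfg.reaches_iterate (c := M.listInit) (a := a t) (fun j => (ha j).1 t) s
  have hlater : ∀ t N, N ≤ t → StateTransition.Reaches (M.step x)
      (((ListCfg.next (a t))^[N] M.listInit).toCfg)
      (((ListCfg.next (a t))^[t] M.listInit).toCfg) := by
    intro t N h
    obtain ⟨d, rfl⟩ := Nat.exists_eq_add_of_le' h
    rw [Function.iterate_add_apply]
    exact ListCfg.reaches_iterate (fun j => (ha j).1 _) d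
  constructor
  · intro t m v hv
    unfold approxOutput at hv
    rw [List.getElem?_append] at hv
    split_ifs at hv with h1 h2
    · rw [List.getElem?_map, Option.map_eq_some_iff] at hv
      obtain ⟨w, hw, rfl⟩ := hv
      exact hy.cell_eq (hreach t t) hw
    · have hstep : M.step x (((ListCfg.next (a t))^[t] M.listInit).toCfg) = none := by
        rcases ListCfg.step_toCfg (x := x) (fun j => (ha j).1 t) h2.1 with ⟨h3, -⟩ | h3
        · exact h3
        · have hj := ListCfg.view_join (x := x) (fun j => (ha j).1 t) h2.1
          have hp := h2.2
          rw [hj] at hp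
          exact congrArg (Option.map _) hp
      rw [hy.cell_eq_of_step_eq_none (hreach t t) hstep m]
      have hv' : v = none := (List.mem_replicate.1 (List.mem_of_getElem? hv)).2
      rw [hv']
      exact List.getElem?_eq_none (not_lt.1 fun h => h1 (by rw [List.length_map]; exact h))
    · simp at hv
  · intro m
    cases κ₀ with
    | word =>
      obtain ⟨d, hd, hd0, rfl⟩ := hy
      obtain ⟨N, T, hT⟩ := eventually_iterate_eq ha hd
      obtain ⟨T', hT'⟩ := eventually_reads ha d.pos
      -- `T` and `T'` ensure that enough input is known to reach and to recognize the halting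
      -- configuration, `N` that `t` steps suffice, and `m + 1` that the `t` appended blanks cover
      -- cell `m`.
      refine ⟨max (max T T') (max N (m + 1)), fun t ht => ?_⟩
      simp only [ge_iff_le, max_le_iff] at ht
      have h1 : ((ListCfg.next (a t))^[t] M.listInit).toCfg = d := by
        have := hlater t N ht.2.1
        rw [hT t ht.1.1] at this
        exact eq_of_reaches_of_step_eq_none this hd0
      have h2 : ∀ j, ((a t j)[((ListCfg.next (a t))^[t] M.listInit).2.1 j]?).isSome := by
        have := hT' t ht.1.2
        rw [← h1] at this
        exact this
      have h3 : (((ListCfg.next (a t))^[t] M.listInit).view (a t)).Halts := by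
        rcases ListCfg.step_toCfg (x := x) (fun j => (ha j).1 t) h2 with ⟨-, h3⟩ | h3
        · exact h3
        · rw [h1, hd0] at h3; cases h3
      change m < (M.approxOutput t (a t)).length
      rw [approxOutput, if_pos h3, List.length_append, List.length_replicate]
      omega
    | seq =>
      obtain ⟨d, hd, hdm⟩ := hy m
      obtain ⟨N, T, hT⟩ := eventually_iterate_eq ha hd
      refine ⟨max T N, fun t ht => ?_⟩
      have := hlater t N (le_of_max_le_right ht)
      rw [hT t (le_of_max_le_left ht)] at this
      have h1 := (output_prefix this).length_le
      have h2 := (List.getElem?_eq_some_iff.1 hdm).1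
      change m < (M.approxOutput t (a t)).length
      rw [approxOutput, List.length_append, List.length_map]
      exact (h2.trans_le h1).trans_le (Nat.le_add_right _ _)

end Correctness

/-! ### Primitive recursiveness -/

instance : Finite Turing.Dir :=
  Finite.of_surjective (fun b : Bool => if b then Turing.Dir.left else .right) fun d => by
    cases d
    exacts [⟨true, rfl⟩, ⟨false, rfl⟩]

theorem primrec_writeMove {S : Type} [Inhabited S] [Primcodable S] [Primcodable Turing.Dir]
    {α : Type*} [Primcodable α] {d : α → Option Turing.Dir} {s : α → S} {T : α → ListTape S}
    (hd : Primrec d) (hs : Primrec s) (hT : Primrec T) :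
    Primrec fun x => (T x).writeMove (d x) (s x) := by
  have h : Primrec₂ fun (d : Option Turing.Dir) (p : S × ListTape S) => p.2.writeMove d p.1 := by
    have hs : Primrec fun p : S × ListTape S => p.1 := Primrec.fst
    have hl : Primrec fun p : S × ListTape S => p.2.1 := Primrec.fst.comp Primrec.snd
    have hr : Primrec fun p : S × ListTape S => p.2.2.2 :=
      Primrec.snd.comp (Primrec.snd.comp Primrec.snd)
    refine primrec_of_finite fun d => ?_
    rcases d with _ | _ | _
    · exact hl.pair (hs.pair hr)
    · exact (Primrec.list_tail.comp hl).pair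
        ((Primrec.list_headI.comp hl).pair (Primrec.list_cons.comp hs hr))
    · exact (Primrec.list_cons.comp hs hl).pair
        ((Primrec.list_headI.comp hr).pair (Primrec.list_tail.comp hr))
  exact h.comp hd (hs.pair hT)

theorem primrec_moveInput [Primcodable Turing.Dir] : Primrec₂ moveInput := by
  refine primrec_of_finite fun d => ?_
  rcases d with _ | _ | _
  · exact Primrec.id
  · exact Primrec.pred
  · exact Primrec.succ

/-- Since `A`, the states and the work alphabet are finite, there are finitely many views, so the
program is a finite table. -/
theorem primrec_approxOutput [Finite A] [Primcodable A] (M : Type2Machine A n) :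
    Primrec₂ M.approxOutput := by
  classical
  let _ : Primcodable M.Q := primcodableOfFinite _
  let _ : Primcodable M.S := primcodableOfFinite _
  let _ : Primcodable Turing.Dir := primcodableOfFinite _
  have hview : Primrec₂ fun (a : Fin n → Approx A) (c : M.ListCfg) => c.view a := by
    refine (Primrec.fst.comp Primrec.snd).pair (Primrec.pair ?_ ?_)
    · refine primrec_pi fun j => ?_
      exact Primrec.list_getElem?.comp (primrec_apply Primrec.fst j)
        (primrec_apply (Primrec.fst.comp (Primrec.snd.comp Primrec.snd)) j)
    · refine primrec_pi fun j => ?_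
      exact Primrec.fst.comp (Primrec.snd.comp (primrec_apply
        (Primrec.fst.comp (Primrec.snd.comp (Primrec.snd.comp Primrec.snd))) j))
  have hnext : Primrec₂ fun (a : Fin n → Approx A) (c : M.ListCfg) => c.next a := by
    refine Primrec.pair ?_ (Primrec.pair ?_ (Primrec.pair ?_ ?_))
    · exact (Primrec.dom_finite fun v : M.View => v.action.next).comp hview
    · refine primrec_pi fun j => ?_
      exact primrec_moveInput.comp
        ((Primrec.dom_finite fun v : M.View => v.action.inputMove j).comp hview)
        (primrec_apply (Primrec.fst.comp (Primrec.snd.comp Primrec.snd)) j)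
    · refine primrec_pi fun j => ?_
      exact primrec_writeMove
        ((Primrec.dom_finite fun v : M.View => v.action.workMove j).comp hview)
        ((Primrec.dom_finite fun v : M.View => v.action.write j).comp hview)
        (primrec_apply (Primrec.fst.comp (Primrec.snd.comp (Primrec.snd.comp Primrec.snd))) j)
    · exact Primrec.list_append.comp
        (Primrec.snd.comp (Primrec.snd.comp (Primrec.snd.comp Primrec.snd)))
        ((Primrec.dom_finite fun v : M.View => v.action.out.toList).comp hview)
  have hiter : Primrec fun p : ℕ × (Fin n → Approx A) =>
      (ListCfg.next p.2)^[p.1] M.listInit :=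
    Primrec.nat_iterate Primrec.fst (Primrec.const _)
      (hnext.comp₂ (Primrec.snd.comp₂ Primrec₂.left) Primrec₂.right)
  have hrep : Primrec fun t : ℕ => List.replicate t (none : Option A) :=
    (Primrec.list_map Primrec.list_range (Primrec₂.const none)).of_eq fun t => by simp
  refine Primrec.list_append.comp
    (Primrec.list_map (Primrec.snd.comp (Primrec.snd.comp (Primrec.snd.comp hiter)))
      (Primrec.option_some.comp₂ Primrec₂.right))
    (Primrec.ite ?_ (hrep.comp Primrec.fst) (Primrec.const []))
  have hh : Primrec fun v : M.View => decide v.Halts := Primrec.dom_finite _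
  exact (hh.comp (hview.comp Primrec.snd hiter)).primrecPred

end Type2Machine

end

section

/-! ## Type-2 machines that evaluate primitive recursive functions -/

namespace StageMachine

open Turing Turing.PartrecToTM2 Turing.ToPartrec

/-- The statements of the stack machines that evaluate codes. -/
abbrev StackStmt := TM2.Stmt (fun _ : K' => Γ') Λ' (Option Γ')

/-- The phases of a stage: reading a symbol from each input tape, running a stack machine (a push
takes two steps), and processing the first number on the main stack. -/
inductive Phase
  | read
  | run (s : StackStmt) (v : Option Γ') (moved : Bool)
  | emit (l : List Γ')

/-- The stacks are kept on the work tapes. -/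
def stackEquiv : Fin 4 ≃ K' where
  toFun := ![.main, .rev, .aux, .stack]
  invFun | .main => 0 | .rev => 1 | .aux => 2 | .stack => 3
  left_inv := by decide
  right_inv := by rintro (_ | _ | _ | _) <;> rfl

variable {A : Type*} {k : ℕ}

/-- The action that affects only one of the work tapes. -/
def action (q : Phase) (h : Fin 4 → Option Γ') (K : K') (w : Option Γ') (d : Option Dir)
    (m : Option Dir) (o : Option A) : Type2Action A k 4 Phase (Option Γ') where
  next := q
  inputMove _ := m
  write j := if stackEquiv j = K then w else h j
  workMove j := if stackEquiv j = K then d else none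
  out := o

/-- The action that changes only the phase. -/
def goto (q : Phase) (h : Fin 4 → Option Γ') : Type2Action A k 4 Phase (Option Γ') :=
  action q h .main (h (stackEquiv.symm .main)) none none none

/-- The program; `code` is evaluated in each stage, and `act` tells how to process the first number
of the result (`some none`: halt, `some (some a)`: write `a` on the output tape). -/
noncomputable def prog (code : (Fin k → Option A) → Code) (act : List Γ' → Option (Option A)) :
    Phase → (Fin k → Option A) → (Fin 4 → Option Γ') →
      Option (Type2Action A k 4 Phase (Option Γ'))
  | .read, i, h =>
      some (action (.run (tr (trNormal (code i) .halt)) none false) h .main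
        (h (stackEquiv.symm .main)) none (some .right) none)
  | .run (.push K f s) v false, _, h =>
      some (action (.run (.push K f s) v true) h K (h (stackEquiv.symm K)) (some .right) none none)
  | .run (.push K f s) v true, _, h =>
      some (action (.run s v false) h K (some (f v)) none none none)
  | .run (.peek K f s) v _, _, h => some (goto (.run s (f v (h (stackEquiv.symm K))) false) h)
  | .run (.pop K f s) v _, _, h =>
      some (action (.run s (f v (h (stackEquiv.symm K))) false) h K none (some .left) none none)
  | .run (.load f s) v _, _, h => some (goto (.run s (f v) false) h)
  | .run (.branch f s₁ s₂) v _, _, h => some (goto (.run (cond (f v) s₁ s₂) v false) h)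
  | .run (.goto f) v _, _, h => some (goto (.run (tr (f v)) v false) h)
  | .run .halt _ _, _, h => some (goto (.emit []) h)
  | .emit l, _, h =>
      match h (stackEquiv.symm .main), act l with
      | none, _ => none
      | some .cons, some none => none
      | some .cons, o => some (action .read h .main none (some .left) none o.join)
      | some s, _ => some (action (.emit (l ++ [s])) h .main none (some .left) none none)

/-- The tape that holds a stack; the head scans the top of the stack. -/
def stackTape (l : List Γ') : Tape (Option Γ') :=
  ⟨l.head?, ListBlank.mk (l.tail.map some), ListBlank.mk []⟩

/-- The tape that holds a stack, with the head on the next cell to the right. -/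
def movedTape (l : List Γ') : Tape (Option Γ') :=
  ⟨none, ListBlank.mk (l.map some), ListBlank.mk []⟩

theorem mk_cons_none (l : List (Option Γ')) (h : l = []) :
    ListBlank.mk (none :: l) = ListBlank.mk [] := by
  subst h
  exact Quotient.sound' (.inr ⟨1, rfl⟩)

/-- A push first moves to a fresh cell and then writes, whereas one machine step writes before
moving; hence two steps. For an empty stack the move leaves a blank behind, which `ListBlank`
identifies with nothing. -/
theorem moveWork_right (l : List Γ') :
    Type2Machine.moveWork (some .right) ((stackTape l).write l.head?) = movedTape l := by
  cases l with
  | nil =>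
    change Tape.mk none (ListBlank.mk [none]) (ListBlank.mk []) = Tape.mk none (ListBlank.mk []) _
    rw [mk_cons_none _ rfl]
  | cons a l => rfl

theorem moveWork_write (l : List Γ') (a : Γ') :
    Type2Machine.moveWork none ((movedTape l).write (some a)) = stackTape (a :: l) := rfl

/-- Blanking the cell before moving left keeps everything to the right of the head blank. -/
theorem moveWork_left (l : List Γ') :
    Type2Machine.moveWork (some .left) ((stackTape l).write none) = stackTape l.tail := by
  have : ∀ L, Tape.mk L (ListBlank.mk (l.tail.tail.map some)) (ListBlank.mk [none]) =
      Tape.mk L (ListBlank.mk (l.tail.tail.map some)) (ListBlank.mk []) := fun L => by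
    rw [mk_cons_none _ rfl]
  rcases l with _ | ⟨a, _ | ⟨b, l⟩⟩ <;> exact this _

variable (R : Set Phase) (code : (Fin k → Option A) → Code) (act : List Γ' → Option (Option A))

open Classical in
/-- The phase as a state of the machine. -/
noncomputable def toState {R : Set Phase} (hread : .read ∈ R) (q : Phase) : R :=
  if h : q ∈ R then ⟨q, h⟩ else ⟨.read, hread⟩

/-- The action of the machine that corresponds to an action on phases. -/
noncomputable def toStateAction {R : Set Phase} (hread : .read ∈ R)
    (a : Type2Action A k 4 Phase (Option Γ')) : Type2Action A k 4 R (Option Γ') :=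
  ⟨toState hread a.next, a.inputMove, a.write, a.workMove, a.out⟩

variable {R} in
/-- The Type-2 machine with phases from a finite set as states. -/
noncomputable def machine (hR : R.Finite) (hread : .read ∈ R) : Type2Machine A k where
  Q := R
  finQ := hR
  S := Option Γ'
  w := 4
  start := ⟨.read, hread⟩
  prog q i h := (prog code act q.1 i h).map (toStateAction hread)

variable {R code act} {hR : R.Finite} {hread : .read ∈ R} {κ : Fin k → NameKind}
  {x : ∀ j, Names A (κ j)}

/-- Configurations of the machine. -/
noncomputable def cfg (hR : R.Finite) (hread : .read ∈ R) (code : (Fin k → Option A) → Code)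
    (act : List Γ' → Option (Option A)) (q : Phase) (t : ℕ) (T : K' → Tape (Option Γ'))
    (out : List A) : (machine code act hR hread).Cfg :=
  ⟨toState hread q, fun _ => t, fun j => T (stackEquiv j), out⟩

/-- Only the executed phase must lie in `R`. If `q'` does not, `toState` falls back to the same
default on both sides, and membership is needed only when `q'` itself is executed. -/
theorem step_cfg {q q' : Phase} (hq : q ∈ R) {t : ℕ} {T : K' → Tape (Option Γ')} {out : List A}
    {K : K'} {w : Option Γ'} {d m : Option Dir} {o : Option A}
    (h : prog code act q (fun j => (x j).cell t) (fun j => (T (stackEquiv j)).head) =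
      some (action q' (fun j => (T (stackEquiv j)).head) K w d m o)) :
    (machine code act hR hread).step x (cfg hR hread code act q t T out) =
      some (cfg hR hread code act q' (Type2Machine.moveInput m t)
        (Function.update T K (Type2Machine.moveWork d ((T K).write w))) (out ++ o.toList)) := by
  have h1 : (toState hread q).1 = q := by rw [toState, dif_pos hq]
  have h2 : (machine code act hR hread).prog (toState hread q) (fun j => (x j).cell t)
      (fun j => (T (stackEquiv j)).head) = some ⟨toState hread q', fun _ => m,
        fun j => if stackEquiv j = K then w else (T (stackEquiv j)).head,
        fun j => if stackEquiv j = K then d else none, o⟩ := by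
    exact (congrArg (fun q => (prog code act q (fun j => (x j).cell t)
      fun j => (T (stackEquiv j)).head).map (toStateAction hread)) h1).trans
      (congrArg (Option.map (toStateAction hread)) h)
  refine (congrArg (Option.map _) h2).trans ?_
  simp only [Option.map_some, cfg]
  congr 3
  funext j
  by_cases hj : stackEquiv j = K
  · subst hj
    simp only [if_true, Function.update_self]
    rfl
  · simp only [hj, if_false, ne_eq, not_false_eq_true, Function.update_of_ne]
    rfl

theorem step_cfg_eq_none {q : Phase} (hq : q ∈ R) {t : ℕ} {T : K' → Tape (Option Γ')}
    {out : List A}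
    (h : prog code act q (fun j => (x j).cell t) (fun j => (T (stackEquiv j)).head) = none) :
    (machine code act hR hread).step x (cfg hR hread code act q t T out) = none := by
  have h1 : (toState hread q).1 = q := by rw [toState, dif_pos hq]
  have h2 : (machine code act hR hread).prog (toState hread q) (fun j => (x j).cell t)
      (fun j => (T (stackEquiv j)).head) = none :=
    (congrArg (fun q => (prog code act q (fun j => (x j).cell t)
      fun j => (T (stackEquiv j)).head).map (toStateAction hread)) h1).trans
      (congrArg (Option.map (toStateAction hread)) h)
  exact congrArg (Option.map _) h2

theorem step_cfg_goto {q q' : Phase} (hq : q ∈ R) {t : ℕ} {T : K' → Tape (Option Γ')}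
    {out : List A}
    (h : prog code act q (fun j => (x j).cell t) (fun j => (T (stackEquiv j)).head) =
      some (goto q' (fun j => (T (stackEquiv j)).head))) :
    (machine code act hR hread).step x (cfg hR hread code act q t T out) =
      some (cfg hR hread code act q' t T out) := by
  rw [step_cfg hq h]
  have h1 : Type2Machine.moveWork none (T .main) = T .main := rfl
  simp [Type2Machine.moveInput, h1]

/-- The tapes that hold the stacks. -/
def tapes (S : K' → List Γ') (K : K') : Tape (Option Γ') := stackTape (S K)

theorem update_tapes (S : K' → List Γ') (K : K') (l : List Γ') :
    Function.update (tapes S) K (stackTape l) = tapes (Function.update S K l) := by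
  funext K'
  by_cases h : K' = K
  · subst h; simp [tapes]
  · simp [tapes, h]

/-- The configuration of the machine that corresponds to a configuration of a stack machine. -/
noncomputable def ofStack (hR : R.Finite) (hread : .read ∈ R) (code : (Fin k → Option A) → Code)
    (act : List Γ' → Option (Option A)) (t : ℕ) (out : List A) :
    TM2.Cfg (fun _ : K' => Γ') Λ' (Option Γ') → (machine code act hR hread).Cfg
  | ⟨some l, v, S⟩ => cfg hR hread code act (.run (tr l) v false) t (tapes S) out
  | ⟨none, _, S⟩ => cfg hR hread code act (.emit []) t (tapes S) out

theorem reaches_stepAux {s : StackStmt}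
    (hs : ∀ s' ∈ TM2.stmts₁ s, ∀ v b, .run s' v b ∈ R) (v : Option Γ') (S : K' → List Γ')
    (t : ℕ) (out : List A) :
    StateTransition.Reaches ((machine code act hR hread).step x)
      (cfg hR hread code act (.run s v false) t (tapes S) out)
      (ofStack hR hread code act t out (TM2.stepAux s v S)) := by
  induction s generalizing v S with
  | push K f s ih =>
    have hm : ∀ v b, .run (TM2.Stmt.push K f s) v b ∈ R := hs _ TM2.stmts₁_self
    refine .head (step_cfg (hm _ _) rfl) (.head (step_cfg (hm _ _) rfl) ?_)
    have h1 : (tapes S K).write ((tapes S (stackEquiv (stackEquiv.symm K))).head) =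
        (stackTape (S K)).write (S K).head? := by
      rw [Equiv.apply_symm_apply]; rfl
    rw [h1, moveWork_right, Function.update_self, Function.update_idem, moveWork_write,
      update_tapes]
    simp only [Option.toList_none, List.append_nil]
    exact ih (fun s' hs' => hs s' (by simp [TM2.stmts₁, hs'])) _ _
  | peek K f s ih =>
    refine .head (step_cfg_goto (hs _ TM2.stmts₁_self _ _) rfl) ?_
    simp only [Equiv.apply_symm_apply]
    exact ih (fun s' hs' => hs s' (by simp [TM2.stmts₁, hs'])) _ _
  | pop K f s ih =>
    refine .head (step_cfg (hs _ TM2.stmts₁_self _ _) rfl) ?_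
    have h1 : (tapes S K).write none = (stackTape (S K)).write none := rfl
    rw [h1, moveWork_left, update_tapes]
    simp only [Equiv.apply_symm_apply, Option.toList_none, List.append_nil]
    exact ih (fun s' hs' => hs s' (by simp [TM2.stmts₁, hs'])) _ _
  | load f s ih =>
    refine .head (step_cfg_goto (hs _ TM2.stmts₁_self _ _) rfl) ?_
    exact ih (fun s' hs' => hs s' (by simp [TM2.stmts₁, hs'])) _ _
  | branch f s₁ s₂ ih₁ ih₂ =>
    refine .head (step_cfg_goto (hs _ TM2.stmts₁_self _ _) rfl) ?_
    rw [TM2.stepAux]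
    cases f v
    · exact ih₂ (fun s' hs' => hs s' (by simp [TM2.stmts₁, hs'])) _ _
    · exact ih₁ (fun s' hs' => hs s' (by simp [TM2.stmts₁, hs'])) _ _
  | goto f => exact .single (step_cfg_goto (hs _ TM2.stmts₁_self _ _) rfl)
  | halt => exact .single (step_cfg_goto (hs _ TM2.stmts₁_self _ _) rfl)

/-- The labels of the stack machine never leave a finite supporting set, so finitely many phases
suffice for the whole evaluation. -/
theorem reaches_ofStack {L : Finset Λ'}
    (hL : ∀ l ∈ L, ∀ s' ∈ TM2.stmts₁ (tr l), ∀ v b, .run s' v b ∈ R)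
    (hsupp : ∀ l ∈ L, TM2.SupportsStmt L (tr l)) {c d : TM2.Cfg (fun _ : K' => Γ') Λ' (Option Γ')}
    (hc : c.l ∈ Finset.insertNone L) (hd : StateTransition.Reaches (TM2.step tr) c d)
    (t : ℕ) (out : List A) :
    StateTransition.Reaches ((machine code act hR hread).step x)
      (ofStack hR hread code act t out c) (ofStack hR hread code act t out d) := by
  induction hd using Relation.ReflTransGen.head_induction_on with
  | refl => exact .refl
  | @head c e hce _ ih =>
    obtain ⟨_ | l, v, S⟩ := c
    · cases hce
    · have hl : l ∈ L := by simpa using hc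
      have he : e.l ∈ Finset.insertNone L :=
        let _ : Inhabited Λ' := ⟨l⟩
        TM2.step_supports tr ⟨hl, hsupp⟩ hce hc
      obtain rfl : TM2.stepAux (tr l) v S = e := Option.some.inj hce
      exact (reaches_stepAux (hL l hl) v S t out).trans (ih he)

end StageMachine

end

/-! ### Evaluating primitive recursive functions stage by stage -/

section

namespace StageMachine

open Turing Turing.PartrecToTM2 Turing.ToPartrec

theorem trPosNum_ne_nil (p : PosNum) : trPosNum p ≠ [] := by cases p <;> simp [trPosNum]

theorem trPosNum_injective : Function.Injective trPosNum := by
  intro p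
  induction p with
  | one =>
    intro q h
    cases q with
    | one => rfl
    | bit1 q => exact absurd (List.cons.inj h).2.symm (trPosNum_ne_nil q)
    | bit0 q => exact Γ'.noConfusion (List.cons.inj h).1
  | bit1 p ih =>
    intro q h
    cases q with
    | one => exact absurd (List.cons.inj h).2 (trPosNum_ne_nil p)
    | bit1 q => rw [ih (List.cons.inj h).2]
    | bit0 q => exact Γ'.noConfusion (List.cons.inj h).1
  | bit0 p ih =>
    intro q h
    cases q with
    | one => exact Γ'.noConfusion (List.cons.inj h).1
    | bit1 q => exact Γ'.noConfusion (List.cons.inj h).1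
    | bit0 q => rw [ih (List.cons.inj h).2]

/-- The finite control recognizes the action of a stage from the binary digits that it pops; this
requires that distinct numbers have distinct digit strings. -/
theorem trNat_injective : Function.Injective trNat := by
  intro m n h
  refine Nat.cast_injective (R := Num) ?_
  unfold trNat at h
  generalize (m : Num) = a at h ⊢
  generalize (n : Num) = b at h ⊢
  cases a <;> cases b
  · rfl
  · exact absurd h.symm (trPosNum_ne_nil _)
  · exact absurd h (trPosNum_ne_nil _)
  · rw [trPosNum_injective h]

theorem exists_code_of_primrec {f : ℕ → ℕ} (hf : Primrec f) :
    ∃ c : Code, ∀ v, c.eval v = pure [f v.headI] := by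
  obtain ⟨c, hc⟩ := Code.exists_code (n := 1) (Nat.Partrec'.of_prim (hf.comp Primrec.vector_head))
  refine ⟨c.comp Code.head, fun v => ?_⟩
  have h1 : (c.comp Code.head).eval v = (Code.head.eval v).bind c.eval :=
    congrFun (Code.comp_eval c Code.head) v
  have h2 : Code.head.eval v = Part.some [v.headI] := Code.head_eval v
  have h3 : c.eval [v.headI] = Part.some [f v.headI] :=
    (hc (v.headI ::ᵥ List.Vector.nil)).trans (Part.map_some _ _)
  exact h1.trans ((congrArg (Part.bind · c.eval) h2).trans ((Part.bind_some _ _).trans h3))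

/-- The first component will be the action, which the control consumes, and the second the new
memory, which stays on the stack as the input of the next stage. -/
theorem exists_code_pair {f g : ℕ → ℕ} (hf : Primrec f) (hg : Primrec g) :
    ∃ c : Code, ∀ v, c.eval v = pure [f v.headI, g v.headI] := by
  obtain ⟨c, hc⟩ := exists_code_of_primrec hf
  obtain ⟨d, hd⟩ := exists_code_of_primrec hg
  refine ⟨c.cons d, fun v => ?_⟩
  have h1 : (c.cons d).eval v = (c.eval v).bind fun n => (d.eval v).bind fun ns =>
    Part.some (n.headI :: ns) := congrFun (Code.cons_eval c d) v
  have hc' : c.eval v = Part.some [f v.headI] := hc v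
  have hd' : d.eval v = Part.some [g v.headI] := hd v
  exact h1.trans ((congrArg₂ (fun p q : Part (List ℕ) => p.bind fun n => q.bind fun ns =>
    Part.some (n.headI :: ns)) hc' hd').trans
      ((Part.bind_some _ _).trans (Part.bind_some _ _)))

variable {A : Type*} {k : ℕ}

section Round

/-- The phases that are needed. -/
def phases (code : (Fin k → Option A) → Code) (num : Option (Option A) → ℕ) : Set Phase :=
  {.read} ∪ (⋃ i, ⋃ l ∈ codeSupp (code i) .halt, ⋃ s ∈ TM2.stmts₁ (tr l),
    Set.range fun p : Option Γ' × Bool => Phase.run s p.1 p.2) ∪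
    ⋃ z, Phase.emit '' {l | l <+: trNat (num z)}

/-- Finiteness of `A` bounds both the number of codes, one for each tuple of symbols read, and the
number of actions whose digit strings have to be recognized. -/
theorem finite_phases [Finite A] (code : (Fin k → Option A) → Code)
    (num : Option (Option A) → ℕ) : (phases code num).Finite := by
  refine ((Set.finite_singleton _).union (Set.finite_iUnion fun i =>
    (Finset.finite_toSet _).biUnion fun l _ => (Finset.finite_toSet _).biUnion fun s _ =>
      Set.finite_range _)).union (Set.finite_iUnion fun z => Set.Finite.image _ ?_)
  refine (List.finite_toSet (trNat (num z)).inits).subset fun l hl => ?_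
  simpa using hl

theorem read_mem_phases (code : (Fin k → Option A) → Code) (num : Option (Option A) → ℕ) :
    .read ∈ phases code num :=
  .inl (.inl rfl)

open Classical in
/-- The inverse function of `num` for numbers in binary notation. -/
noncomputable def decodeAct (num : Option (Option A) → ℕ) (l : List Γ') : Option (Option A) :=
  if h : ∃ z, trNat (num z) = l then h.choose else none

theorem decodeAct_trNat {num : Option (Option A) → ℕ} (hnum : Function.Injective num)
    (z : Option (Option A)) : decodeAct num (trNat (num z)) = z := by
  have h : ∃ z', trNat (num z') = trNat (num z) := ⟨z, rfl⟩
  rw [decodeAct, dif_pos h]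
  exact hnum (trNat_injective h.choose_spec)

variable {R : Set Phase} {code : (Fin k → Option A) → Code} {act : List Γ' → Option (Option A)}
  {hR : R.Finite} {hread : .read ∈ R} {κ : Fin k → NameKind} {x : ∀ j, Names A (κ j)}

theorem head_tapes_main (l : List Γ') :
    (tapes (K'.elim l [] [] []) (stackEquiv (stackEquiv.symm .main))).head = l.head? := rfl

theorem update_tapes_main (l l' : List Γ') :
    Function.update (tapes (K'.elim l [] [] [])) .main (stackTape l') =
      tapes (K'.elim l' [] [] []) := by
  rw [update_tapes, K'.elim_update_main]

/-- The digits popped are remembered in the phase; the separator `cons` does not occur among them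
and so marks their end. -/
theorem reaches_emit {t : ℕ} {out : List A} {rest : List Γ'} (r : List Γ')
    (hr : ∀ s ∈ r, natEnd s = false) (l : List Γ') (hl : ∀ p, p <+: l ++ r → .emit p ∈ R) :
    StateTransition.Reaches ((machine code act hR hread).step x)
      (cfg hR hread code act (.emit l) t (tapes (K'.elim (r ++ rest) [] [] [])) out)
      (cfg hR hread code act (.emit (l ++ r)) t (tapes (K'.elim rest [] [] [])) out) := by
  induction r generalizing l with
  | nil => rw [List.append_nil]; exact .refl
  | cons s r ih =>
    have hs : s ≠ .cons := by rintro rfl; simpa using hr _ List.mem_cons_self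
    have h := ih (fun s' hs' => hr s' (List.mem_cons_of_mem _ hs')) (l ++ [s])
      (by simpa using hl)
    rw [List.append_assoc, List.singleton_append] at h
    refine .head (step_cfg (q' := .emit (l ++ [s])) (K := .main) (w := none) (d := some .left)
      (m := none) (o := none) (hl l (List.prefix_append _ _)) ?_) ?_
    · simp only [prog, head_tapes_main]
      cases s
      · rfl
      · exact absurd rfl hs
      · rfl
      · rfl
    · have h1 := moveWork_left (s :: r ++ rest)
      change StateTransition.Reaches _ (cfg hR hread code act _ t (Function.update _ _
        (Type2Machine.moveWork (some .left) ((stackTape (s :: r ++ rest)).write none))) _) _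
      rw [h1, update_tapes_main, Option.toList_none, List.append_nil]
      exact h

variable {num : Option (Option A) → ℕ} {g : (Fin k → Option A) → ℕ → ℕ × Option (Option A)}

/-- Configurations of the machine at the beginning of a stage. -/
noncomputable def stageCfg [Finite A] (code : (Fin k → Option A) → Code)
    (num : Option (Option A) → ℕ) (t : ℕ) (v : List ℕ) (out : List A) :
    (machine code (decodeAct num) (finite_phases code num) (read_mem_phases code num)).Cfg :=
  cfg _ _ _ _ .read t (tapes (K'.elim (trList v) [] [] [])) out

theorem reaches_emit_of_code [Finite A]
    (hcode : ∀ i v, (code i).eval v = pure [num (g i v.headI).2, (g i v.headI).1])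
    (t : ℕ) (v : List ℕ) (out : List A) :
    StateTransition.Reaches
      ((machine code (decodeAct num) (finite_phases code num) (read_mem_phases code num)).step x)
      (stageCfg code num t v out)
      (cfg _ _ _ _ (.emit (trNat (num (g (fun j => (x j).cell t) v.headI).2))) (t + 1)
        (tapes (K'.elim (.cons :: trList [(g (fun j => (x j).cell t) v.headI).1]) [] [] []))
        out) := by
  set i : Fin k → Option A := fun j => (x j).cell t with hi
  have hev : halt [num (g i v.headI).2, (g i v.headI).1] ∈
      StateTransition.eval (TM2.step tr) (init (code i) v) := by
    rw [tr_eval, hcode]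
    exact (Part.mem_map_iff _).2 ⟨_, Part.mem_some _, rfl⟩
  have hreach := (StateTransition.mem_eval.1 hev).1
  have hsupp := tr_supports (code i) .halt
  refine .head (step_cfg (read_mem_phases code num) rfl) ?_
  have h1 : Type2Machine.moveWork none ((tapes (K'.elim (trList v) [] [] []) .main).write
      (tapes (K'.elim (trList v) [] [] []) (stackEquiv (stackEquiv.symm .main))).head) =
      tapes (K'.elim (trList v) [] [] []) .main := rfl
  rw [h1, Function.update_eq_self, Option.toList_none, List.append_nil]
  refine (reaches_ofStack (L := codeSupp (code i) .halt) (fun l hl s hs v b => ?_) hsupp.2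
    (Finset.some_mem_insertNone.2 hsupp.1) hreach (t + 1) out).trans ?_
  · refine .inl (.inr ?_)
    simp only [Set.mem_iUnion]
    exact ⟨i, l, hl, s, hs, (v, b), rfl⟩
  · have := reaches_emit (R := phases code num) (code := code) (act := decodeAct num)
      (hR := finite_phases code num) (hread := read_mem_phases code num) (x := x) (t := t + 1)
      (out := out) (rest := .cons :: trList [(g i v.headI).1]) (trNat (num (g i v.headI).2))
      (trNat_natEnd _) [] (fun p hp => .inr (Set.mem_iUnion.2 ⟨_, p, hp, rfl⟩))
    exact this

theorem reaches_stageCfg_succ [Finite A] (hnum : Function.Injective num)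
    (hcode : ∀ i v, (code i).eval v = pure [num (g i v.headI).2, (g i v.headI).1])
    (t : ℕ) (v : List ℕ) (out : List A)
    (hz : (g (fun j => (x j).cell t) v.headI).2 ≠ some none) :
    StateTransition.Reaches
      ((machine code (decodeAct num) (finite_phases code num) (read_mem_phases code num)).step x)
      (stageCfg code num t v out)
      (stageCfg code num (t + 1) [(g (fun j => (x j).cell t) v.headI).1]
        (out ++ (g (fun j => (x j).cell t) v.headI).2.join.toList)) := by
  refine (reaches_emit_of_code hcode t v out).tail ?_
  generalize (g (fun j => (x j).cell t) v.headI) = p at hz ⊢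
  refine (step_cfg (q' := .read) (K := .main) (w := none) (d := some .left)
      (m := none) (o := p.2.join)
      (.inr (Set.mem_iUnion.2 ⟨_, _, List.prefix_rfl, rfl⟩)) ?_).trans ?_
  · simp only [prog, head_tapes_main, decodeAct_trNat hnum]
    rcases p with ⟨n, _ | _ | a⟩
    · rfl
    · exact absurd rfl hz
    · rfl
  -- Popping the separator leaves exactly the encoded memory as the main stack.
  · have h1 := moveWork_left (.cons :: trList [p.1])
    change some (cfg _ _ _ _ _ _ (Function.update _ _
        (Type2Machine.moveWork (some .left) ((stackTape (.cons :: trList [p.1])).write none))) _) =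
      _
    rw [h1, update_tapes_main]
    rfl

theorem exists_halting_cfg [Finite A] (hnum : Function.Injective num)
    (hcode : ∀ i v, (code i).eval v = pure [num (g i v.headI).2, (g i v.headI).1])
    (t : ℕ) (v : List ℕ) (out : List A)
    (hz : (g (fun j => (x j).cell t) v.headI).2 = some none) :
    ∃ c, StateTransition.Reaches
      ((machine code (decodeAct num) (finite_phases code num) (read_mem_phases code num)).step x)
      (stageCfg code num t v out) c ∧
      (machine code (decodeAct num) (finite_phases code num) (read_mem_phases code num)).step x c
        = none ∧ c.output = out := by
  refine ⟨_, reaches_emit_of_code hcode t v out, ?_, rfl⟩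
  rw [hz]
  refine step_cfg_eq_none (.inr (Set.mem_iUnion.2 ⟨_, _, List.prefix_rfl, rfl⟩)) ?_
  simp only [prog, head_tapes_main, decodeAct_trNat hnum]
  rfl

end Round

end StageMachine

end

section

namespace StageMachine

open Turing Turing.PartrecToTM2 Turing.ToPartrec

/-! ### The machine for a primitive recursive approximation of a function -/

variable {A : Type*} {k : ℕ}

/-- The number of stages that have been completed, the symbols that have been read, and the number
of symbols that have been written. -/
abbrev Memory (A : Type*) (k : ℕ) := ℕ × (Fin k → Approx A) × ℕ

section

variable [Primcodable A]

/-- The code of a memory content; `0` is reserved for the initial content. -/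
def encodeMemory (m : Memory A k) : ℕ :=
  (Encodable.encode (self := Primcodable.toEncodable) m) + 1

/-- The content of the memory with a given code. -/
def decodeMemory (σ : ℕ) : Memory A k :=
  σ.casesOn (0, fun _ => [], 0) fun σ =>
    (Encodable.decode (self := Primcodable.toEncodable) σ).getD (0, fun _ => [], 0)

/-- The memory after reading the symbols `i`. -/
def updateMemory (i : Fin k → Option A) (m : Memory A k) : Memory A k :=
  (m.1 + 1, fun j => m.2.1 j ++ [i j], m.2.2)

/-- The action of a stage, given the updated memory. -/
def stageAct (H : ℕ → (Fin k → Approx A) → Approx A) (m : Memory A k) : Option (Option A) :=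
  (H m.1 m.2.1)[m.2.2]?

/-- The memory after a stage. -/
def nextMemory (H : ℕ → (Fin k → Approx A) → Approx A) (m : Memory A k) : Memory A k :=
  (m.1, m.2.1, m.2.2 + (stageAct H m).join.toList.length)

/-- The code of the memory after a stage and the action of the stage. -/
def stage (H : ℕ → (Fin k → Approx A) → Approx A) (i : Fin k → Option A) (σ : ℕ) :
    ℕ × Option (Option A) :=
  (encodeMemory (nextMemory H (updateMemory i (decodeMemory σ))),
    stageAct H (updateMemory i (decodeMemory σ)))

theorem decodeMemory_zero : decodeMemory 0 = ((0, fun _ => [], 0) : Memory A k) := rfl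

theorem decodeMemory_encode (m : Memory A k) : decodeMemory (encodeMemory m) = m :=
  congrArg (fun o : Option (Memory A k) => o.getD (0, fun _ => [], 0))
    (@Encodable.encodek _ Primcodable.toEncodable m)

theorem primrec_stage [Finite A] {H : ℕ → (Fin k → Approx A) → Approx A} (hH : Primrec₂ H)
    (i : Fin k → Option A) : Primrec (stage H i) := by
  have hdec : Primrec fun σ => (decodeMemory σ : Memory A k) := by
    refine Primrec.nat_casesOn Primrec.id (Primrec.const _) ?_
    exact Primrec.option_getD.comp (Primrec.decode.comp Primrec.snd) (Primrec.const _)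
  have henc : Primrec fun m : Memory A k => encodeMemory m := Primrec.succ.comp Primrec.encode
  have hupd : Primrec fun m : Memory A k => updateMemory i m := by
    refine (Primrec.succ.comp Primrec.fst).pair (Primrec.pair ?_ (Primrec.snd.comp Primrec.snd))
    exact primrec_pi fun j => Primrec.list_append.comp
      (primrec_apply (Primrec.fst.comp Primrec.snd) j) (Primrec.const _)
  have hm := hupd.comp hdec
  have hact : Primrec (stageAct H) := Primrec.list_getElem?.comp
    (hH.comp Primrec.fst (Primrec.fst.comp Primrec.snd)) (Primrec.snd.comp Primrec.snd)
  have hlen : Primrec fun z : Option (Option A) => z.join.toList.length := Primrec.dom_finite _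
  have hnext : Primrec (nextMemory H) :=
    Primrec.fst.pair ((Primrec.fst.comp Primrec.snd).pair
      (Primrec.nat_add.comp (Primrec.snd.comp Primrec.snd) (hlen.comp hact)))
  unfold stage
  exact (henc.comp (hnext.comp hm)).pair (hact.comp hm)

theorem exists_code_stage [Finite A] {H : ℕ → (Fin k → Approx A) → Approx A} (hH : Primrec₂ H) :
    ∃ code : (Fin k → Option A) → Code, ∀ i v, (code i).eval v =
      pure [Encodable.encode (stage H i v.headI).2, (stage H i v.headI).1] := by
  have := fun i => exists_code_pair (Primrec.encode.comp (Primrec.snd.comp (primrec_stage hH i)))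
    (Primrec.fst.comp (primrec_stage hH i))
  choose code hcode using this
  exact ⟨code, hcode⟩

end

variable {κ : Fin k → NameKind} {κ₀ : NameKind}

/-- The word that has been written before stage `t`. -/
def stageOutput (H : ℕ → (Fin k → Approx A) → Approx A) (x : ∀ j, Names A (κ j)) : ℕ → List A
  | 0 => []
  | t + 1 => stageOutput H x t ++
      ((H (t + 1) fun j => (x j).take (t + 1))[(stageOutput H x t).length]?).join.toList

variable {H : ℕ → (Fin k → Approx A) → Approx A} {x : ∀ j, Names A (κ j)} {y : Names A κ₀}

/-- The only symbol a stage may append is the entry of a correct approximation at the position equal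
to the current output length. -/
theorem stageOutput_cell (hy : Conv (fun t => H t fun j => (x j).take t) y) (t m : ℕ) (v : A)
    (h : (stageOutput H x t)[m]? = some v) : y.cell m = some v := by
  induction t with
  | zero => simp [stageOutput] at h
  | succ t ih =>
    rw [stageOutput, List.getElem?_append] at h
    split_ifs at h with hm
    · exact ih h
    · rcases ho : (H (t + 1) fun j => (x j).take (t + 1))[(stageOutput H x t).length]?
        with _ | _ | a
      · simp [ho] at h
      · simp [ho] at h
      · simp only [ho, Option.join_some, Option.toList_some] at h
        obtain ⟨h1, h2⟩ := List.getElem?_eq_some_iff.1 h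
        simp only [List.length_singleton] at h1
        obtain rfl : m = (stageOutput H x t).length := by omega
        simp only [Nat.sub_self, List.getElem_cons_zero] at h2
        subst h2
        exact hy.1 (t + 1) _ _ ho

/-- Once the approximations cover cell `m`, an output of length `m` cannot stall: the entry there is
known and, by `hz`, is not a blank, so it is written. -/
theorem exists_le_length_stageOutput (hy : Conv (fun t => H t fun j => (x j).take t) y)
    (hz : ∀ t, (H (t + 1) fun j => (x j).take (t + 1))[(stageOutput H x t).length]? ≠ some none)
    (m : ℕ) : ∃ t, m ≤ (stageOutput H x t).length := by
  induction m with
  | zero => exact ⟨0, Nat.zero_le _⟩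
  | succ m ih =>
    obtain ⟨t, ht⟩ := ih
    obtain ⟨T, hT⟩ := hy.2 m
    have hmono : m ≤ (stageOutput H x (t + T)).length := by
      clear hT
      induction T with
      | zero => exact ht
      | succ T ih =>
        rw [← Nat.add_assoc, stageOutput, List.length_append]
        omega
    rcases hmono.lt_or_eq with h | h
    · exact ⟨_, h⟩
    · refine ⟨t + T + 1, ?_⟩
      have h1 := hz (t + T)
      have h2 := hT (t + T + 1) (by omega)
      rw [stageOutput, List.length_append, ← h]
      rw [← h, List.getElem?_eq_getElem h2] at h1
      rw [List.getElem?_eq_getElem h2]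
      rcases ho : (H (t + T + 1) fun j => (x j).take (t + T + 1))[m] with _ | a
      · exact absurd (congrArg some ho) h1
      · simp

variable [Primcodable A]

theorem stage_headI {v : List ℕ} {t n : ℕ}
    (hv : decodeMemory v.headI = ((t, fun j => (x j).take t, n) : Memory A k)) :
    stage H (fun j => (x j).cell t) v.headI =
      (encodeMemory ((t + 1, fun j => (x j).take (t + 1),
        n + ((H (t + 1) fun j => (x j).take (t + 1))[n]?).join.toList.length) : Memory A k),
        (H (t + 1) fun j => (x j).take (t + 1))[n]?) := by
  simp only [stage, nextMemory, hv, updateMemory, stageAct, ← Names.take_succ]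

theorem reaches_stageCfg [Finite A] {code : (Fin k → Option A) → Code}
    (hcode : ∀ i v, (code i).eval v =
      pure [Encodable.encode (stage H i v.headI).2, (stage H i v.headI).1])
    (t : ℕ) (hz : ∀ s < t,
      (H (s + 1) fun j => (x j).take (s + 1))[(stageOutput H x s).length]? ≠ some none) :
    ∃ v : List ℕ,
      decodeMemory v.headI = ((t, fun j => (x j).take t, (stageOutput H x t).length) : Memory A k) ∧
      StateTransition.Reaches ((machine code (decodeAct Encodable.encode) (finite_phases code _)
        (read_mem_phases code _)).step x) (Type2Machine.init _)
        (stageCfg code Encodable.encode t v (stageOutput H x t)) := by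
  induction t with
  | zero =>
    -- The blank tapes encode the empty list, whose `headI` is `0`, the number reserved for the
    -- initial memory.
    refine ⟨[], decodeMemory_zero, ?_⟩
    have : (Type2Machine.init _) = stageCfg code Encodable.encode 0 [] [] := by
      simp only [Type2Machine.init, stageCfg, cfg, machine]
      congr 1
      · rw [toState, dif_pos (read_mem_phases code _)]
      · funext j
        fin_cases j <;> rfl
    rw [this]
    exact .refl
  | succ t ih =>
    obtain ⟨v, hv, hreach⟩ := ih fun s hs => hz s (hs.trans (Nat.lt_succ_self t))
    have hst := stage_headI (H := H) hv
    have h := reaches_stageCfg_succ (x := x) Encodable.encode_injective hcode t v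
      (stageOutput H x t) (by rw [hst]; exact hz t (Nat.lt_succ_self t))
    rw [hst] at h
    refine ⟨_, ?_, hreach.trans h⟩
    rw [List.headI_cons, decodeMemory_encode, stageOutput, List.length_append]

/-- One machine serves for every type specification: it halts when `H` reports a blank at the next
output position, which happens for words and never for sequences. -/
theorem exists_type2Machine [Finite A] (hH : Primrec₂ H) : ∃ M : Type2Machine A k,
    ∀ (κ : Fin k → NameKind) (κ₀ : NameKind) (x : ∀ j, Names A (κ j)) (y : Names A κ₀),
      Conv (fun t => H t fun j => (x j).take t) y → M.Computes x y := by
  obtain ⟨code, hcode⟩ := exists_code_stage hH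
  refine ⟨machine code (decodeAct Encodable.encode) (finite_phases code Encodable.encode)
    (read_mem_phases code _), fun κ κ₀ x y hy => ?_⟩
  cases κ₀ with
  | word =>
    have hhalt : ∃ t,
        (H (t + 1) fun j => (x j).take (t + 1))[(stageOutput H x t).length]? = some none := by
      by_contra hn
      push Not at hn
      -- Without halting the output would eventually have a symbol at position `|y|`, where the word
      -- `y` is blank.
      obtain ⟨t, ht⟩ := exists_le_length_stageOutput hy hn (List.length (α := A) y + 1)
      have h1 := stageOutput_cell hy t _ _ (List.getElem?_eq_getElem ht)
      have h2 : Names.cell y (List.length (α := A) y) = none :=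
        List.getElem?_eq_none (l := (y : List A)) le_rfl
      rw [h2] at h1
      cases h1
    classical
    obtain ⟨v, hv, hreach⟩ := reaches_stageCfg (x := x) hcode (Nat.find hhalt) fun s hs =>
      Nat.find_min hhalt hs
    have hz := Nat.find_spec hhalt
    generalize Nat.find hhalt = t at hv hreach hz
    obtain ⟨c, hc, hc0, hout⟩ := exists_halting_cfg (x := x) Encodable.encode_injective hcode t v
      (stageOutput H x t) (by rw [stage_headI hv]; exact hz)
    refine ⟨c, hreach.trans hc, hc0, hout.trans ?_⟩
    -- The blank that causes halting shows that the output is no shorter than `y`; correctness of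
    -- the symbols written gives the rest.
    have h1 : Names.cell y (stageOutput H x t).length = none := hy.1 (t + 1) _ _ hz
    have h2 : List.length (α := A) y ≤ (stageOutput H x t).length :=
      List.getElem?_eq_none_iff.1 h1
    refine List.ext_getElem? fun m => ?_
    rcases lt_or_ge m (stageOutput H x t).length with hm | hm
    · rw [List.getElem?_eq_getElem hm]
      exact (stageOutput_cell hy t _ _ (List.getElem?_eq_getElem hm)).symm
    · rw [List.getElem?_eq_none hm]
      exact (List.getElem?_eq_none (l := (y : List A)) (h2.trans hm)).symm
  | seq =>
    have hz : ∀ t, (H (t + 1) fun j => (x j).take (t + 1))[(stageOutput H x t).length]? ≠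
        some none := by
      intro t ht
      have : Names.cell y _ = none := hy.1 _ _ _ ht
      cases this
    intro m
    obtain ⟨t, ht⟩ := exists_le_length_stageOutput hy hz (m + 1)
    obtain ⟨v, -, hreach⟩ := reaches_stageCfg (x := x) hcode t fun s _ => hz s
    refine ⟨_, hreach, ?_⟩
    change (stageOutput H x t)[m]? = _
    rw [List.getElem?_eq_getElem ht]
    exact (stageOutput_cell hy t _ _ (List.getElem?_eq_getElem ht)).symm

end StageMachine

end

section

/-! ## Realization of the function computed by a generalized Turing machine -/

variable {A : Type*}

theorem Tracks.mono {n : ℕ} {κ : Fin n → NameKind} {κ₀ : NameKind}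
    {h : ℕ → (Fin n → Approx A) → Approx A} {f g : (∀ j, Names A (κ j)) → Set (Names A κ₀)}
    (hg : Tracks h g) (hfg : ∀ x, f x ⊆ g x) : Tracks h f :=
  fun x y hy => hg x y (hfg x hy)

/-- Every single-valued multi-function is a partial function. -/
theorem exists_toMulti_eq {X Y : Type*} {F : X → Set Y}
    (hF : ∀ x, ∀ y ∈ F x, ∀ y' ∈ F x, y = y') : ∃ f : X →. Y, toMulti f = F := by
  classical
  refine ⟨fun x => ⟨∃ y, y ∈ F x, fun h => h.choose⟩, funext fun x => Set.ext fun y => ?_⟩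
  exact ⟨fun ⟨h, hy⟩ => hy ▸ h.choose_spec,
    fun hy => ⟨⟨y, hy⟩, hF x _ (Exists.choose_spec (⟨y, hy⟩ : ∃ y, y ∈ F x)) y hy⟩⟩

section

variable {n : ℕ} {κ : Fin n → NameKind} {κ₀ : NameKind} {Z : Fin n → Type*} {Z₀ : Type*}
  {δ : ∀ j, Names A (κ j) → Set (Z j)} {δ₀ : Names A κ₀ → Set Z₀} {g : (∀ j, Z j) → Set Z₀}

/-- The multi-function `g` has a realization that is tracked by some `h` such that `C h`. -/
def HasTrackedRealization (C : ∀ n, (ℕ → (Fin n → Approx A) → Approx A) → Prop)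
    (δ : ∀ j, Names A (κ j) → Set (Z j)) (δ₀ : Names A κ₀ → Set Z₀)
    (g : (∀ j, Z j) → Set Z₀) : Prop :=
  ∃ (f : (∀ j, Names A (κ j)) →. Names A κ₀) (h : ℕ → (Fin n → Approx A) → Approx A),
    C n h ∧ Tracks h (toMulti f) ∧ Realizes δ δ₀ (toMulti f) g

theorem RelComputable.hasTrackedRealization [Finite A] [Primcodable A]
    (hg : RelComputable δ δ₀ g) :
    HasTrackedRealization (fun _ h => Primrec₂ h) δ δ₀ g := by
  obtain ⟨f, ⟨e, ⟨M, hM⟩, hfe⟩, hf⟩ := hg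
  exact ⟨f, M.approxOutput, Type2Machine.primrec_approxOutput M,
    Type2Machine.tracks_approxOutput.mono fun x y hy => (hM x y).1 (hfe x y hy), hf⟩

theorem RelContinuous.hasTrackedRealization (hg : RelContinuous δ δ₀ g) :
    HasTrackedRealization (fun _ _ => True) δ δ₀ g := by
  obtain ⟨f, hc, hf⟩ := hg
  obtain ⟨h, hh⟩ := exists_tracks_of_isContinuous hc
  exact ⟨f, h, trivial, hh, hf⟩

/-- The stage machine computes an extension `e` of the tracked function `f`. That its results form a
partial function follows by tracking the machine itself. -/
theorem HasTrackedRealization.relComputable [Finite A] [Primcodable A]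
    (hg : HasTrackedRealization (fun _ h => Primrec₂ h) δ δ₀ g) : RelComputable δ δ₀ g := by
  obtain ⟨f, h, hp, hh, hf⟩ := hg
  obtain ⟨M, hM⟩ := StageMachine.exists_type2Machine hp
  obtain ⟨e, he⟩ := exists_toMulti_eq
    (F := fun x : ∀ j, Names A (κ j) => {y : Names A κ₀ | M.Computes x y})
    fun x y hy y' hy' => Type2Machine.tracks_approxOutput.unique hy hy'
  have hmem : ∀ x y, y ∈ e x ↔ M.Computes x y := fun x y =>
    Set.ext_iff.1 (congrFun he x) y
  exact ⟨f, ⟨e, ⟨M, hmem⟩, fun x y hy =>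
    (hmem x y).2 (hM κ κ₀ x y (hh x y hy _ fun j => (x j).conv_take))⟩, hf⟩

theorem HasTrackedRealization.relContinuous
    (hg : HasTrackedRealization (fun _ _ => True) δ δ₀ g) : RelContinuous δ δ₀ g := by
  obtain ⟨f, h, -, hh, hf⟩ := hg
  exact ⟨f, isContinuous_of_tracks hh, hf⟩

end

variable [Zero A] [One A]

/-- The functions in the statement have realizations that are tracked by functions with `C`. -/
def StmtHasTrackedRealization (C : ∀ n, (ℕ → (Fin n → Approx A) → Approx A) → Prop)
    {Lab Γ : Type} {L : ℕ} {X : Fin (L + 1) → Type*} {κ : Fin (L + 1) → NameKind}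
    (δ : ∀ i, Names A (κ i) → Set (X i)) : Stmt A Lab Γ X → Prop
  | .assign i _ idx f _ => HasTrackedRealization C (fun j => δ (idx j)) (δ i) f
  | .branch _ idx f _ _ _ => HasTrackedRealization C (fun j => δ (idx j)) (idWord A) (toMulti f)
  | _ => True

variable {C : ∀ n, (ℕ → (Fin n → Approx A) → Approx A) → Prop}

theorem StmtHasTrackedRealization.exists_stmt {Lab Γ : Type} {L : ℕ} {X : Fin (L + 1) → Type*}
    {κ : Fin (L + 1) → NameKind} {δ : ∀ i, Names A (κ i) → Set (X i)} {s : Stmt A Lab Γ X}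
    (h : StmtHasTrackedRealization C δ s) :
    ∃ (s' : Stmt A Lab Γ fun i => Names A (κ i)) (s'' : ApproxStmt A Lab Γ (L + 1)),
      StmtRealizes δ s s' ∧ StmtTracks s' s'' ∧ s''.All C := by
  cases s with
  | right i l' => exact ⟨_, _, .right i l', .right i l', trivial⟩
  | left i l' => exact ⟨_, _, .left i l', .left i l', trivial⟩
  | write i a l' => exact ⟨_, _, .write i a l', .write i a l', trivial⟩
  | test i a l' l'' => exact ⟨_, _, .test i a l' l'', .test i a l' l'', trivial⟩
  | assign i n idx f l' =>
    obtain ⟨F, H, hC, hH, hF⟩ := h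
    exact ⟨_, _, .assign i n idx f _ l' hF, .assign i n idx _ H l' hH, hC⟩
  | branch n idx f hf l' l'' =>
    obtain ⟨F, H, hC, hH, hF⟩ := h
    obtain ⟨G, hG⟩ := exists_toMulti_eq (F := fun x => {v : List A | v ∈ F x ∧ (v = [0] ∨ v = [1])})
      fun x y hy y' hy' => Part.mem_unique hy.1 hy'.1
    have hmem : ∀ x v, v ∈ G x ↔ v ∈ F x ∧ (v = [0] ∨ v = [1]) := fun x v =>
      Set.ext_iff.1 (congrFun hG x) v
    have hR : Realizes (fun j => δ (idx j)) (idWord A) (toMulti G) (toMulti f) := by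
      intro x y hxy hne
      obtain ⟨⟨v, hv⟩, hval⟩ := hF x y hxy hne
      refine ⟨⟨v, (hmem x v).2 ⟨hv, ?_⟩⟩, fun w hw => hval w ((hmem x w).1 hw).1⟩
      obtain ⟨w, hw, rfl⟩ := hval v hv
      exact hf y w hw
    exact ⟨_, _, .branch n idx f hf G (fun x v hv => ((hmem x v).1 hv).2) l' l'' hR,
      .branch n idx G _ H l' l'' (hH.mono fun x v hv => ((hmem x v).1 hv).1), hC⟩

namespace GTM

variable {P : GTM A} {κ : Fin (P.L + 1) → NameKind} {δ : ∀ i, Names A (κ i) → Set (P.X i)}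

/-- The property `C` is "primitive recursive" for computability and void for continuity, so both
halves of the theorem share one proof; `hC` isolates the only point where they differ. -/
theorem hasTrackedRealization_fn (h01 : (0 : A) ≠ 1)
    (h : ∀ l, StmtHasTrackedRealization C δ (P.stm l))
    (hC : ∀ hs : {l : P.Lab // l ≠ P.lf} → ApproxStmt A P.Lab P.Γ (P.L + 1),
      (∀ l, (hs l).All C) → C P.k (P.approxResult hs)) :
    HasTrackedRealization C (fun j => δ (P.inTape j)) (δ 0) P.fn := by
  choose stm' hs hR hT hall using fun l => (h l).exists_stmt
  have ht := tracks_approxResult h01 hT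
  obtain ⟨f, hf⟩ := exists_toMulti_eq fun x y hy y' hy' => ht.unique (x := x) hy hy'
  refine ⟨f, P.approxResult hs, hC hs hall, ?_, ?_⟩
  · rw [hf]; exact ht
  · rw [hf]; exact realizes_results hR

theorem RelComputable.relComputable_fn [Finite A] (h01 : (0 : A) ≠ 1) (h : P.RelComputable δ) :
    TTE.RelComputable (fun j => δ (P.inTape j)) (δ 0) P.fn := by
  have := P.finLab
  have := P.finΓ
  let _ : Primcodable A := primcodableOfFinite A
  let _ : Primcodable P.Lab := primcodableOfFinite P.Lab
  let _ : Primcodable P.Γ := primcodableOfFinite P.Γ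
  refine (hasTrackedRealization_fn h01 (fun l => ?_) fun _ hall =>
    P.primrec_approxResult hall).relComputable
  have hl := h l
  generalize P.stm l = s at hl ⊢
  cases s with
  | right | left | write | test => trivial
  | assign | branch => exact hl.hasTrackedRealization

theorem RelContinuous.relContinuous_fn (h01 : (0 : A) ≠ 1) (h : P.RelContinuous δ) :
    TTE.RelContinuous (fun j => δ (P.inTape j)) (δ 0) P.fn := by
  refine (hasTrackedRealization_fn h01 (fun l => ?_) fun _ _ => trivial).relContinuous
  have hl := h l
  generalize P.stm l = s at hl ⊢
  cases s with
  | right | left | write | test => trivial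
  | assign | branch => exact hl.hasTrackedRealization

end GTM

end

end TTE

theorem mainTheorem8 {A : Type*} [Finite A] [Zero A] [One A] (h01 : (0 : A) ≠ 1)
    (P : TTE.GTM A) (κ : Fin (P.L + 1) → TTE.NameKind)
    (δ : ∀ i, TTE.Names A (κ i) → Set (P.X i)) (hδ : ∀ i, TTE.IsMultiRep (δ i)) :
    (P.RelComputable δ → TTE.RelComputable (fun j => δ (P.inTape j)) (δ 0) P.fn) ∧
      (P.RelContinuous δ → TTE.RelContinuous (fun j => δ (P.inTape j)) (δ 0) P.fn) :=
  ⟨fun h => h.relComputable_fn h01, fun h => h.relContinuous_fn h01⟩
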